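/- Let $I,J\subseteq\mathbb R$ and $U_k\subseteq\mathbb R$ $(k\ge 0)$ be nonempty open intervals with $0\notin U_0$. Let $\Omega$ be the set of points $(t,x,u,u_1,u_2,\dots)$ with $t\in I$, $x\in J$, $u=u_0\in U_0$ and $u_k\in U_k$ for all $k\ge1$ (here $u_1=u_x$, $u_2=u_{xx}$, etc.). A differential function on $\Omega$ is a smooth function of $t,x$ and finitely many of the $u_k$. For a smooth function $\beta(t,x)$ on $I\times J$ consider the equation $$u_t=F:=\beta_x u^2u_{xx}+2\beta_{xx}u^2u_x+4\beta u_x+(\beta_{xxx}-4\beta_x)u^3-4\beta_x u ,\qquad (\ast)$$ and the total derivatives $D_x=\partial_x+\sum_k u_{k+1}\partial_{u_k}$ and $D_t=\partial_t+\sum_k (D_x^kF)\,\partial_{u_k}$. A local conservation law of $(\ast)$ is a pair $(\rho,\sigma)$ of differential functions on $\Omega$ with $D_t\rho=D_x\sigma$ on $\Omega$. It is trivial if $\rho=D_xf$ and $\sigma=D_tf$ for some differential function $f$ on $\Omega$. (1) Suppose that $\beta_x\neq0$ everywhere on $I\times J$. Then $(\ast)$ has a nontrivial local conservation law if and only if there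 are smooth functions $p,q$ of $t\in I$ such that $(pq)_t\ne0$ everywhere on $I$, $pe^{2x}-qe^{-2x}\neq0$ everywhere on $I\times J$, and $$\beta=\frac18\,\frac{p_te^{2x}+q_te^{-2x}}{pe^{2x}-qe^{-2x}}\quad\text{on } I\times J.\qquad(\ast\ast)$$ (2) If $p,q$ are smooth functions on $I$ with $(pq)_t\ne0$ everywhere on $I$ and $pe^{2x}-qe^{-2x}\ne0$ everywhere on $I\times J$, and $\beta$ is given by $(\ast\ast)$, then $\beta$ is smooth with $\beta_x\ne0$ everywhere on $I\times J$, and $(\ast)$ has exactly one nontrivial local conservation law up to constant multiples and trivial conservation laws, namely $$D_t\frac{pe^{2x}+qe^{-2x}}{u}=D_x\Big(\frac12\frac{(pq)_t(pe^{2x}+qe^{-2x})}{(pe^{2x}-qe^{-2x})^2}u_x+\frac12\frac{(p_te^{2x}+q_te^{-2x})(pe^{2x}+qe^{-2x})}{pe^{2x}-qe^{-2x}}\frac1u-\frac{(pq)_t(3p^2e^{4x}+2pq+3q^2e^{-4x})}{(pe^{2x}-qe^{-2x})^3}u\Big).$$ That is, this law holds and is nontrivial, and for every local conservation law $(\rho,\sigma)$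 there is a unique constant $c\in\mathbb R$ such that $(\rho,\sigma)$ minus $c$ times this law is trivial. -/

import Mathlib

open scoped ContDiff

noncomputable section

/-- A point of the equation manifold of a scalar evolution equation: the coordinates are `t`, `x`
and the jet coordinates `u 0 = u`, `u 1 = u_x`, `u 2 = u_xx`, and so on. -/
structure JetPoint where
  t : ℝ
  x : ℝ
  u : ℕ → ℝ

namespace JetPoint

/-- The partial derivative with respect to `t`. -/
def dt (f : JetPoint → ℝ) (z : JetPoint) : ℝ :=
  deriv (fun s => f ⟨s, z.x, z.u⟩) z.t

/-- The partial derivative with respect to `x`. -/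
def dx (f : JetPoint → ℝ) (z : JetPoint) : ℝ :=
  deriv (fun s => f ⟨z.t, s, z.u⟩) z.x

/-- The partial derivative with respect to the jet coordinate `u k`. -/
def du (k : ℕ) (f : JetPoint → ℝ) (z : JetPoint) : ℝ :=
  deriv (fun s => f ⟨z.t, z.x, Function.update z.u k s⟩) (z.u k)

/-- The total derivative `D_x = ∂/∂x + ∑ u_{k+1} ∂/∂u_k`. The sum is finite for functions that
depend on finitely many jet coordinates. -/
def totalDx (f : JetPoint → ℝ) (z : JetPoint) : ℝ :=
  dx f z + ∑ᶠ k : ℕ, z.u (k + 1) * du k f z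

/-- The total derivative `D_t = ∂/∂t + ∑ (D_x^k F) ∂/∂u_k` along the equation `u_t = F`. -/
def totalDt (F f : JetPoint → ℝ) (z : JetPoint) : ℝ :=
  dt f z + ∑ᶠ k : ℕ, (totalDx^[k] F) z * du k f z

end JetPoint

/-- A coordinate box in the equation manifold: `t`, `x` and each jet coordinate `u k` range over
nonempty open intervals (bounded or not). -/
structure JetBox where
  I : Set ℝ
  J : Set ℝ
  U : ℕ → Set ℝ
  isOpen_I : IsOpen I
  isOpen_J : IsOpen J
  isOpen_U : ∀ k, IsOpen (U k)
  ordConnected_I : I.OrdConnected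
  ordConnected_J : J.OrdConnected
  ordConnected_U : ∀ k, (U k).OrdConnected
  nonempty_I : I.Nonempty
  nonempty_J : J.Nonempty
  nonempty_U : ∀ k, (U k).Nonempty

namespace JetBox

/-- The points of the box. -/
def carrier (B : JetBox) : Set JetPoint :=
  {z | z.t ∈ B.I ∧ z.x ∈ B.J ∧ ∀ k, z.u k ∈ B.U k}

/-- The projection of the box to the coordinates `t, x, u_0, …, u_{n-1}`. -/
def finiteBox (B : JetBox) (n : ℕ) : Set (ℝ × ℝ × (Fin n → ℝ)) :=
  {y | y.1 ∈ B.I ∧ y.2.1 ∈ B.J ∧ ∀ i : Fin n, y.2.2 i ∈ B.U i}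

/-- `f` is a smooth function on the box, depending on finitely many jet coordinates
(a differential function). -/
def IsDifferentialFunction (B : JetBox) (f : JetPoint → ℝ) : Prop :=
  ∃ (n : ℕ) (g : ℝ × ℝ × (Fin n → ℝ) → ℝ), ContDiffOn ℝ ∞ g (B.finiteBox n) ∧
    ∀ z ∈ B.carrier, f z = g (z.t, z.x, fun i => z.u i)

/-- `D_t ρ = D_x σ` holds on the box as a consequence of `u_t = F`, that is, `ρ` and `σ` are the
density and the flux of a (possibly trivial) local conservation law. -/
structure IsConservationLaw (B : JetBox) (F ρ σ : JetPoint → ℝ) : Prop where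
  density : B.IsDifferentialFunction ρ
  flux : B.IsDifferentialFunction σ
  law : ∀ z ∈ B.carrier, JetPoint.totalDt F ρ z = JetPoint.totalDx σ z

/-- The conservation law with density `ρ` and flux `σ` is trivial: `ρ = D_x f` and `σ = D_t f` for
a differential function `f` on the box. -/
def IsTrivialLaw (B : JetBox) (F ρ σ : JetPoint → ℝ) : Prop :=
  ∃ f : JetPoint → ℝ, B.IsDifferentialFunction f ∧
    ∀ z ∈ B.carrier, ρ z = JetPoint.totalDx f z ∧ σ z = JetPoint.totalDt F f z

/-- The parameter `β` of the class: a smooth function of `t, x` with `∂β/∂x ≠ 0`. -/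
structure IsParameter (B : JetBox) (β : ℝ → ℝ → ℝ) : Prop where
  smooth : ContDiffOn ℝ ∞ (fun y : ℝ × ℝ => β y.1 y.2) (B.I ×ˢ B.J)
  deriv_ne_zero : ∀ t ∈ B.I, ∀ x ∈ B.J, deriv (β t) x ≠ 0

/-- `β = (1/8) (p_t e^{2x} + q_t e^{-2x}) / (p e^{2x} - q e^{-2x})`, with smooth functions `p, q`
of `t` such that `(pq)_t ≠ 0`, the denominator having no zeros. -/
structure IsSpecialParameter (B : JetBox) (β : ℝ → ℝ → ℝ) (p q : ℝ → ℝ) : Prop where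
  smooth_p : ContDiffOn ℝ ∞ p B.I
  smooth_q : ContDiffOn ℝ ∞ q B.I
  deriv_mul_ne_zero : ∀ t ∈ B.I, deriv (fun s => p s * q s) t ≠ 0
  denom_ne_zero : ∀ t ∈ B.I, ∀ x ∈ B.J,
    p t * Real.exp (2 * x) - q t * Real.exp (-2 * x) ≠ 0
  eq : ∀ t ∈ B.I, ∀ x ∈ B.J,
    β t x = 1 / 8 * ((deriv p t * Real.exp (2 * x) + deriv q t * Real.exp (-2 * x)) /
      (p t * Real.exp (2 * x) - q t * Real.exp (-2 * x)))

end JetBox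

/-- The right-hand side of the equation with parameter `β`:
`β_x u² u_xx + 2 β_xx u² u_x + 4 β u_x + (β_xxx - 4 β_x) u³ - 4 β_x u`. -/
def evolutionRHS (β : ℝ → ℝ → ℝ) (z : JetPoint) : ℝ :=
  deriv (β z.t) z.x * z.u 0 ^ 2 * z.u 2
    + 2 * iteratedDeriv 2 (β z.t) z.x * z.u 0 ^ 2 * z.u 1
    + 4 * β z.t z.x * z.u 1
    + (iteratedDeriv 3 (β z.t) z.x - 4 * deriv (β z.t) z.x) * z.u 0 ^ 3
    - 4 * deriv (β z.t) z.x * z.u 0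

/-- The density `(p e^{2x} + q e^{-2x}) / u`. -/
def specialDensity (p q : ℝ → ℝ) (z : JetPoint) : ℝ :=
  (p z.t * Real.exp (2 * z.x) + q z.t * Real.exp (-2 * z.x)) / z.u 0

/-- The flux of the explicit conservation law. -/
def specialFlux (p q : ℝ → ℝ) (z : JetPoint) : ℝ :=
  1 / 2 * (deriv (fun s => p s * q s) z.t
        * (p z.t * Real.exp (2 * z.x) + q z.t * Real.exp (-2 * z.x))
      / (p z.t * Real.exp (2 * z.x) - q z.t * Real.exp (-2 * z.x)) ^ 2) * z.u 1
    + 1 / 2 * ((deriv p z.t * Real.exp (2 * z.x) + deriv q z.t * Real.exp (-2 * z.x))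
        * (p z.t * Real.exp (2 * z.x) + q z.t * Real.exp (-2 * z.x))
      / (p z.t * Real.exp (2 * z.x) - q z.t * Real.exp (-2 * z.x))) * (1 / z.u 0)
    - deriv (fun s => p s * q s) z.t
        * (3 * p z.t ^ 2 * Real.exp (4 * z.x) + 2 * p z.t * q z.t
          + 3 * q z.t ^ 2 * Real.exp (-4 * z.x))
      / (p z.t * Real.exp (2 * z.x) - q z.t * Real.exp (-2 * z.x)) ^ 3 * z.u 0

end

/-!
The right-hand side is quasilinear of second order, so modulo a total derivative `D_x f` every
density has order zero: at each higher order its second derivative in the top jet variable vanishes,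
and the remaining linear part is removed by an integration. For a density of order zero the
conservation law splits into determining equations, which force the density, up to another total
derivative, to be `h / u` with `h(t, x)` a solution of `h_xx = 4 h` and `h_t = 4 β h_x`.

Equality of the mixed derivatives `h_xxt` and `h_txx` gives `8 β_x h = -β_xx h_x`. As `β_x ≠ 0`, the
function `h_x` solves homogeneous linear ordinary differential equations in `t` and in `x`, so it
vanishes nowhere or identically, and the solutions `h` form a space of dimension at most one.
Writing `h = p e^{2x} + q e^{-2x}` turns `h_t = 4 β h_x` into the formula for `β`, and `β_x` is
`-(pq)_t / (2 (p e^{2x} - q e^{-2x})^2)`.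

Finally, a flux `σ` with `D_x σ = 0` depends on `t` only. Its primitive shows that a law with
density `D_x f` is trivial, so laws are determined by their densities.
-/

noncomputable section

open Set Filter Topology

/-! ### Integrals depending smoothly on a parameter -/

section Primitive

universe v

variable {E F : Type v} [NormedAddCommGroup E] [NormedSpace ℝ E]
  [NormedAddCommGroup F] [NormedSpace ℝ F] {S : Set E} {W : Set (E × ℝ)} {a b : ℝ}

theorem exists_eventually_norm_lt_of_continuousOn {X G : Type*} [TopologicalSpace X]
    [SeminormedAddCommGroup G] {Θ : Set ℝ} {W : Set (X × ℝ)} (hΘ : IsCompact Θ) (hW : IsOpen W)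
    {g : X × ℝ → G} (hg : ContinuousOn g W) {y : X} (hyW : ∀ θ ∈ Θ, (y, θ) ∈ W) :
    ∃ C, ∀ᶠ y' in 𝓝 y, ∀ θ ∈ Θ, (y', θ) ∈ W ∧ ‖g (y', θ)‖ < C := by
  obtain ⟨C, hC⟩ := hΘ.exists_bound_of_continuousOn
    (hg.comp (f := fun θ : ℝ => (y, θ)) (by fun_prop) hyW)
  refine ⟨C + 1, ?_⟩
  refine hΘ.eventually_forall_of_forall_eventually fun θ hθ => ?_
  have hθW : W ∈ 𝓝 (y, θ) := hW.mem_nhds (hyW θ hθ)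
  have hlt : ‖g (y, θ)‖ < C + 1 := (hC θ hθ).trans_lt (lt_add_one C)
  exact (eventually_mem_set.2 hθW).and
    ((hg.continuousAt hθW).norm.eventually_lt continuousAt_const hlt)

theorem hasFDerivAt_intervalIntegral_of_contDiffOn (hW : IsOpen W)
    {f : E × ℝ → F} (hf : ContDiffOn ℝ 1 f W) {y : E} (hyW : ∀ θ ∈ uIcc a b, (y, θ) ∈ W) :
    HasFDerivAt (fun y => ∫ θ in a..b, f (y, θ))
      (∫ θ in a..b, (fderiv ℝ f (y, θ)).comp (ContinuousLinearMap.inl ℝ E ℝ)) y := by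
  have hD : ContinuousOn (fun w => (fderiv ℝ f w).comp (ContinuousLinearMap.inl ℝ E ℝ)) W :=
    (hf.continuousOn_fderiv_of_isOpen hW le_rfl).clm_comp continuousOn_const
  have hslice (y' : E) : ContinuousOn (fun θ : ℝ => (y', θ)) (uIcc a b) := by fun_prop
  obtain ⟨C, hC⟩ := exists_eventually_norm_lt_of_continuousOn isCompact_uIcc hW hD hyW
  have hfy : ∀ᶠ y' in 𝓝 y, ContinuousOn (fun θ : ℝ => f (y', θ)) (uIcc a b) :=
    hC.mono fun y' hy' => hf.continuousOn.comp (hslice y') fun θ hθ => (hy' θ hθ).1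
  refine intervalIntegral.hasFDerivAt_integral_of_dominated_of_fderiv_le
    (bound := fun _ => C) hC
    (hfy.mono fun y' hy' =>
      (hy'.mono uIoc_subset_uIcc).aestronglyMeasurable measurableSet_uIoc)
    hfy.self_of_nhds.intervalIntegrable
    (((hD.comp (hslice y) hyW).mono uIoc_subset_uIcc).aestronglyMeasurable measurableSet_uIoc)
    (.of_forall fun θ hθ y' hy' => (hy' θ (uIoc_subset_uIcc hθ)).2.le)
    intervalIntegrable_const (.of_forall fun θ hθ y' hy' => ?_)
  have hmem : (y', θ) ∈ W := (hy' θ (uIoc_subset_uIcc hθ)).1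
  exact ((hf.contDiffAt (hW.mem_nhds hmem)).differentiableAt one_ne_zero).hasFDerivAt.comp y'
    (hasFDerivAt_prodMk_left y' θ)

theorem contDiffOn_intervalIntegral (hS : IsOpen S) (hW : IsOpen W)
    (hSW : ∀ y ∈ S, ∀ θ ∈ uIcc a b, (y, θ) ∈ W) {f : E × ℝ → F} (hf : ContDiffOn ℝ ∞ f W) :
    ContDiffOn ℝ ∞ (fun y => ∫ θ in a..b, f (y, θ)) S := by
  rw [contDiffOn_infty]
  intro n
  have hderiv {F : Type v} [NormedAddCommGroup F] [NormedSpace ℝ F] {f : E × ℝ → F}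
      (hf : ContDiffOn ℝ ∞ f W) (y : E) (hy : y ∈ S) :=
    hasFDerivAt_intervalIntegral_of_contDiffOn hW (hf.of_le (by simp)) (hSW y hy)
  induction n generalizing F with
  | zero =>
    exact contDiffOn_zero.2 fun y hy => (hderiv hf y hy).continuousAt.continuousWithinAt
  | succ n ih =>
    rw [Nat.cast_succ, contDiffOn_succ_iff_fderiv_of_isOpen hS]
    refine ⟨fun y hy => (hderiv hf y hy).differentiableAt.differentiableWithinAt, by simp, ?_⟩
    have hfderiv : ContDiffOn ℝ ∞
        (fun w => (fderiv ℝ f w).comp (ContinuousLinearMap.inl ℝ E ℝ)) W :=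
      ((contDiffOn_infty_iff_fderiv_of_isOpen hW).1 hf).2.clm_comp contDiffOn_const
    exact (ih hfderiv).congr fun y hy => (hderiv hf y hy).fderiv

variable {ℓ : E →L[ℝ] ℝ} {v : E}

theorem add_smul_mem_of_mem_uIcc {y : E} {c r : ℝ} (hS : Convex ℝ S) (hy : y ∈ S)
    (hc : y + c • v ∈ S) (hr : r ∈ uIcc c 0) : y + r • v ∈ S := by
  rw [uIcc_comm, ← segment_eq_uIcc, segment_eq_image] at hr
  obtain ⟨θ, hθ, rfl⟩ := hr
  simpa [mul_smul] using hS.add_smul_mem hy hc hθ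

theorem hasLineDerivAt_sub_smul_integral [CompleteSpace F] (hS : IsOpen S) (hconv : Convex ℝ S)
    (hv : ℓ v = 1) {g : E → F} (hg : ContinuousOn g S) {y : E} (hy : y ∈ S)
    (ha : y + (a - ℓ y) • v ∈ S) :
    HasLineDerivAt ℝ
      (fun y => (ℓ y - a) • ∫ θ in (0 : ℝ)..1, g (y + ((1 - θ) * (a - ℓ y)) • v)) (g y) y v := by
  have hline (s : ℝ) : (ℓ (y + s • v) - a) •
      (∫ θ in (0 : ℝ)..1, g (y + s • v + ((1 - θ) * (a - ℓ (y + s • v))) • v)) =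
        ∫ r in (a - ℓ y)..s, g (y + r • v) := by
    have hparam (θ : ℝ) : y + s • v + ((1 - θ) * (a - ℓ (y + s • v))) • v =
        y + ((ℓ (y + s • v) - a) * θ + (a - ℓ y)) • v := by
      rw [add_assoc, ← add_smul]
      simp only [map_add, map_smul, hv, smul_eq_mul, mul_one]
      ring_nf
    simp only [hparam]
    rw [intervalIntegral.smul_integral_comp_mul_add (f := fun r => g (y + r • v))]
    simp [hv, add_comm]
  have hcont : ContinuousOn (fun r : ℝ => g (y + r • v)) ((fun r : ℝ => y + r • v) ⁻¹' S) :=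
    hg.comp (by fun_prop) fun _ h => h
  have hopen : IsOpen ((fun r : ℝ => y + r • v) ⁻¹' S) := hS.preimage (by fun_prop)
  have h0 : (0 : ℝ) ∈ (fun r : ℝ => y + r • v) ⁻¹' S := by simpa using hy
  have hftc := intervalIntegral.integral_hasDerivAt_right
    (hcont.mono fun r hr => add_smul_mem_of_mem_uIcc hconv hy ha hr).intervalIntegrable
    (hcont.stronglyMeasurableAtFilter hopen 0 h0) (hcont.continuousAt (hopen.mem_nhds h0))
  simpa only [HasLineDerivAt, hline, zero_smul, add_zero] using hftc

theorem exists_contDiffOn_fderiv_apply_eq [CompleteSpace F] (hS : IsOpen S) (hconv : Convex ℝ S)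
    (hv : ℓ v = 1) (ha : ∀ y ∈ S, y + (a - ℓ y) • v ∈ S) {g : E → F} (hg : ContDiffOn ℝ ∞ g S) :
    ∃ G : E → F, ContDiffOn ℝ ∞ G S ∧ ∀ y ∈ S, fderiv ℝ G y v = g y := by
  set φ : E × ℝ → E := fun w => w.1 + ((1 - w.2) * (a - ℓ w.1)) • v with hφ
  have hφ_smooth : ContDiff ℝ ∞ φ := by fun_prop
  have hφ_mem (y : E) (hy : y ∈ S) (θ : ℝ) (hθ : θ ∈ uIcc (0 : ℝ) 1) : φ (y, θ) ∈ S := by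
    rw [uIcc_of_le zero_le_one] at hθ
    simpa only [hφ, mul_smul] using
      hconv.add_smul_mem hy (ha y hy) ⟨sub_nonneg.2 hθ.2, sub_le_self 1 hθ.1⟩
  have hG : ContDiffOn ℝ ∞ (fun y => (ℓ y - a) • ∫ θ in (0 : ℝ)..1, g (φ (y, θ))) S :=
    ContDiffOn.smul (by fun_prop) (contDiffOn_intervalIntegral (W := φ ⁻¹' S)
      (f := fun w => g (φ w)) hS (hS.preimage hφ_smooth.continuous) hφ_mem
      (hg.comp hφ_smooth.contDiffOn fun w hw => hw))
  refine ⟨_, hG, fun y hy => ?_⟩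
  rw [← ((hG.contDiffAt (hS.mem_nhds hy)).differentiableAt (by simp)).lineDeriv_eq_fderiv]
  exact (hasLineDerivAt_sub_smul_integral hS hconv hv hg.continuousOn hy (ha y hy)).lineDeriv

end Primitive

/-! ### Coordinates and partial derivatives -/

/-- The coordinates of the jet space, used to treat the partial derivatives with respect to `t`,
`x` and the `u k` uniformly. -/
inductive JetCoord
  | t
  | x
  | u (k : ℕ)

namespace JetPoint

variable {i j : JetCoord}

/-- The value of a coordinate. -/
def get (z : JetPoint) : JetCoord → ℝ
  | .t => z.t
  | .x => z.x
  | .u k => z.u k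

/-- The point with the value of one coordinate replaced. -/
def set (z : JetPoint) : JetCoord → ℝ → JetPoint
  | .t, s => ⟨s, z.x, z.u⟩
  | .x, s => ⟨z.t, s, z.u⟩
  | .u k, s => ⟨z.t, z.x, Function.update z.u k s⟩

/-- The partial derivative with respect to a coordinate; it unfolds to `JetPoint.dt`, `JetPoint.dx`
or `JetPoint.du k`. -/
def pd (i : JetCoord) (f : JetPoint → ℝ) (z : JetPoint) : ℝ :=
  deriv (fun s => f (z.set i s)) (z.get i)

/-- The derivation `∂_i + ∑ c_k ∂/∂u_k`, of which `D_x` and `D_t` are instances. -/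
def evol (i : JetCoord) (c : ℕ → JetPoint → ℝ) (f : JetPoint → ℝ) (z : JetPoint) : ℝ :=
  pd i f z + ∑ᶠ k : ℕ, c k z * pd (.u k) f z

/-- The coordinates `t, x, u 0, …, u (n - 1)` of a point. -/
def proj (n : ℕ) (z : JetPoint) : ℝ × ℝ × (Fin n → ℝ) := (z.t, z.x, fun i => z.u i)

theorem totalDx_eq_evol : totalDx = evol .x fun k z => z.u (k + 1) := rfl

theorem totalDt_eq_evol (F : JetPoint → ℝ) : totalDt F = evol .t fun k => totalDx^[k] F := rfl

@[simp] theorem set_get (z : JetPoint) (i : JetCoord) : z.set i (z.get i) = z := by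
  cases i <;> simp [set, get]

@[simp] theorem get_set (z : JetPoint) (i : JetCoord) (s : ℝ) : (z.set i s).get i = s := by
  cases i <;> simp [set, get]

theorem get_set_of_ne (z : JetPoint) (h : j ≠ i) (s : ℝ) : (z.set i s).get j = z.get j := by
  cases i <;> cases j <;> simp_all [set, get]

@[simp] theorem set_set (z : JetPoint) (i : JetCoord) (s r : ℝ) :
    (z.set i s).set i r = z.set i r := by
  cases i <;> simp [set]

theorem pd_const (i : JetCoord) (c : ℝ) (z : JetPoint) : pd i (fun _ => c) z = 0 := by
  simp [pd]

theorem pd_get_self (i : JetCoord) (z : JetPoint) : pd i (fun z => z.get i) z = 1 := by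
  simp [pd]

theorem pd_get_of_ne (h : j ≠ i) (z : JetPoint) : pd i (fun z => z.get j) z = 0 := by
  simp [pd, get_set_of_ne _ h]

theorem pd_const_mul (i : JetCoord) (c : ℝ) (f : JetPoint → ℝ) (z : JetPoint) :
    pd i (fun z => c * f z) z = c * pd i f z := by
  simp [pd]

theorem evol_const (i : JetCoord) (c : ℕ → JetPoint → ℝ) (a : ℝ) (z : JetPoint) :
    evol i c (fun _ => a) z = 0 := by
  simp [evol, pd_const]

theorem evol_const_mul (i : JetCoord) (c : ℕ → JetPoint → ℝ) (a : ℝ) (f : JetPoint → ℝ)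
    (z : JetPoint) : evol i c (fun z => a * f z) z = a * evol i c f z := by
  have hsmul := smul_finsum a fun k => c k z * pd (.u k) f z
  simp only [smul_eq_mul, mul_left_comm a] at hsmul
  simp only [evol, pd_const_mul, mul_add, hsmul]

theorem totalDx_const_mul (a : ℝ) (f : JetPoint → ℝ) (z : JetPoint) :
    totalDx (fun z => a * f z) z = a * totalDx f z := by
  rw [totalDx_eq_evol, evol_const_mul]

theorem totalDt_const_mul (F : JetPoint → ℝ) (a : ℝ) (f : JetPoint → ℝ) (z : JetPoint) :
    totalDt F (fun z => a * f z) z = a * totalDt F f z := by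
  rw [totalDt_eq_evol, evol_const_mul]

end JetPoint

open JetPoint

namespace JetCoord

/-- The direction in which a coordinate increases, in the space of the coordinates
`t, x, u 0, …, u (n - 1)`. It is `0` for `u k` with `n ≤ k`. -/
def dir (n : ℕ) : JetCoord → ℝ × ℝ × (Fin n → ℝ)
  | .t => (1, 0, 0)
  | .x => (0, 1, 0)
  | .u k => (0, 0, fun i => if (i : ℕ) = k then 1 else 0)

theorem dir_u_of_le {n k : ℕ} (h : n ≤ k) : dir n (.u k) = 0 := by
  have hne (i : Fin n) : (i : ℕ) ≠ k := (i.2.trans_le h).ne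
  simp only [dir, hne, if_false]
  rfl

theorem proj_set (n : ℕ) (z : JetPoint) (i : JetCoord) (s : ℝ) :
    proj n (z.set i s) = proj n z + (s - z.get i) • i.dir n := by
  cases i with
  | t => simp [proj, JetPoint.set, JetPoint.get, dir]
  | x => simp [proj, JetPoint.set, JetPoint.get, dir]
  | u k =>
    simp only [proj, JetPoint.set, JetPoint.get, dir, Prod.smul_mk, Prod.mk_add_mk, smul_zero,
      add_zero]
    congr 2
    funext j
    by_cases h : (j : ℕ) = k
    · subst h; simp
    · simp [h]

theorem exists_clm_proj_eq_get {n : ℕ} {i : JetCoord} (hi : ∀ k, i = .u k → k < n) :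
    ∃ ℓ : (ℝ × ℝ × (Fin n → ℝ)) →L[ℝ] ℝ, (∀ z, ℓ (proj n z) = z.get i) ∧ ℓ (i.dir n) = 1 := by
  cases i with
  | t => exact ⟨.fst ℝ _ _, fun z => rfl, rfl⟩
  | x => exact ⟨(ContinuousLinearMap.fst ℝ _ _).comp (.snd ℝ _ _), fun z => rfl, rfl⟩
  | u k =>
    exact ⟨(ContinuousLinearMap.proj (⟨k, hi k rfl⟩ : Fin n)).comp
      ((ContinuousLinearMap.snd ℝ _ _).comp (.snd ℝ _ _)), fun z => rfl, by simp [dir]⟩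

end JetCoord

namespace JetBox

variable {B : JetBox} {n m k : ℕ} {i : JetCoord} {z : JetPoint} {f f' : JetPoint → ℝ}

/-- The interval in which a coordinate ranges. -/
def range (B : JetBox) : JetCoord → Set ℝ
  | .t => B.I
  | .x => B.J
  | .u k => B.U k

theorem isOpen_range (i : JetCoord) : IsOpen (B.range i) := by
  cases i
  exacts [B.isOpen_I, B.isOpen_J, B.isOpen_U _]

theorem convex_range (i : JetCoord) : Convex ℝ (B.range i) := by
  cases i
  exacts [B.ordConnected_I.convex, B.ordConnected_J.convex, (B.ordConnected_U _).convex]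

theorem nonempty_range (i : JetCoord) : (B.range i).Nonempty := by
  cases i
  exacts [B.nonempty_I, B.nonempty_J, B.nonempty_U _]

theorem mem_carrier : z ∈ B.carrier ↔ ∀ i, z.get i ∈ B.range i :=
  ⟨fun h i => by cases i; exacts [h.1, h.2.1, h.2.2 _],
    fun h => ⟨h .t, h .x, fun k => h (.u k)⟩⟩

theorem get_mem (hz : z ∈ B.carrier) (i : JetCoord) : z.get i ∈ B.range i :=
  mem_carrier.1 hz i

theorem set_mem (hz : z ∈ B.carrier) {s : ℝ} (hs : s ∈ B.range i) : z.set i s ∈ B.carrier := by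
  refine mem_carrier.2 fun j => ?_
  by_cases h : j = i
  · subst h; simpa using hs
  · rw [get_set_of_ne _ h]; exact get_mem hz j

theorem carrier_nonempty : B.carrier.Nonempty := by
  choose u hu using B.nonempty_U
  exact ⟨⟨_, _, u⟩, B.nonempty_I.choose_spec, B.nonempty_J.choose_spec, hu⟩

theorem eventually_set_mem (hz : z ∈ B.carrier) (i : JetCoord) :
    ∀ᶠ s in 𝓝 (z.get i), z.set i s ∈ B.carrier :=
  Filter.Eventually.mono ((isOpen_range i).mem_nhds (get_mem hz i)) fun _ hs => set_mem hz hs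

theorem finiteBox_eq_prod (B : JetBox) (n : ℕ) :
    B.finiteBox n = B.I ×ˢ B.J ×ˢ univ.pi fun i : Fin n => B.U i := by
  ext y
  simp [finiteBox]

theorem isOpen_finiteBox (n : ℕ) : IsOpen (B.finiteBox n) := by
  rw [finiteBox_eq_prod]
  exact B.isOpen_I.prod (B.isOpen_J.prod (isOpen_set_pi finite_univ fun i _ => B.isOpen_U i))

theorem convex_finiteBox (n : ℕ) : Convex ℝ (B.finiteBox n) := by
  rw [finiteBox_eq_prod]
  exact B.ordConnected_I.convex.prod
    (B.ordConnected_J.convex.prod (convex_pi fun i _ => (B.ordConnected_U i).convex))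

theorem proj_mem (hz : z ∈ B.carrier) (n : ℕ) : proj n z ∈ B.finiteBox n :=
  ⟨hz.1, hz.2.1, fun i => hz.2.2 i⟩

theorem exists_proj_eq {y : ℝ × ℝ × (Fin n → ℝ)} (hy : y ∈ B.finiteBox n) :
    ∃ z ∈ B.carrier, proj n z = y := by
  choose u hu using B.nonempty_U
  refine ⟨⟨y.1, y.2.1, fun k => if h : k < n then y.2.2 ⟨k, h⟩ else u k⟩,
    ⟨hy.1, hy.2.1, fun k => ?_⟩, ?_⟩
  · by_cases h : k < n
    · simpa [h] using hy.2.2 ⟨k, h⟩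
    · simpa [h] using hu k
  · simp [proj]

/-- `f` is a differential function of order less than `n`: on the box it is a smooth function of
`t, x, u 0, …, u (n - 1)`. In particular `B.OrderLT 0 f` says that `f` depends on `t, x` only. -/
def OrderLT (B : JetBox) (n : ℕ) (f : JetPoint → ℝ) : Prop :=
  ∃ g : ℝ × ℝ × (Fin n → ℝ) → ℝ, ContDiffOn ℝ ∞ g (B.finiteBox n) ∧
    ∀ z ∈ B.carrier, f z = g (proj n z)

theorem isDifferentialFunction_iff :
    B.IsDifferentialFunction f ↔ ∃ n, B.OrderLT n f := Iff.rfl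

namespace OrderLT

theorem congr (h : B.OrderLT n f) (he : EqOn f' f B.carrier) : B.OrderLT n f' := by
  obtain ⟨g, hg, hfg⟩ := h
  exact ⟨g, hg, fun z hz => (he hz).trans (hfg z hz)⟩

theorem mono (h : B.OrderLT n f) (hnm : n ≤ m) : B.OrderLT m f := by
  obtain ⟨g, hg, hfg⟩ := h
  exact ⟨fun y => g (y.1, y.2.1, fun i => y.2.2 (Fin.castLE hnm i)),
    hg.comp (ContDiff.contDiffOn (by fun_prop))
      fun y hy => ⟨hy.1, hy.2.1, fun i => hy.2.2 (Fin.castLE hnm i)⟩, hfg⟩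

theorem isDifferentialFunction (h : B.OrderLT n f) : B.IsDifferentialFunction f := ⟨n, h⟩

theorem const (n : ℕ) (c : ℝ) : B.OrderLT n fun _ => c :=
  ⟨fun _ => c, contDiffOn_const, fun _ _ => rfl⟩

theorem add (h : B.OrderLT n f) (h' : B.OrderLT n f') : B.OrderLT n fun z => f z + f' z := by
  obtain ⟨g, hg, hfg⟩ := h
  obtain ⟨g', hg', hfg'⟩ := h'
  exact ⟨fun y => g y + g' y, hg.add hg', fun z hz => by simp only [hfg z hz, hfg' z hz]⟩

theorem mul (h : B.OrderLT n f) (h' : B.OrderLT n f') : B.OrderLT n fun z => f z * f' z := by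
  obtain ⟨g, hg, hfg⟩ := h
  obtain ⟨g', hg', hfg'⟩ := h'
  exact ⟨fun y => g y * g' y, hg.mul hg', fun z hz => by simp only [hfg z hz, hfg' z hz]⟩

theorem neg (h : B.OrderLT n f) : B.OrderLT n fun z => -f z := by
  simpa only [neg_one_mul] using (const n (-1)).mul h

theorem sub (h : B.OrderLT n f) (h' : B.OrderLT n f') : B.OrderLT n fun z => f z - f' z := by
  simpa only [sub_eq_add_neg] using h.add h'.neg

theorem pow (h : B.OrderLT n f) (k : ℕ) : B.OrderLT n fun z => f z ^ k := by
  obtain ⟨g, hg, hfg⟩ := h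
  exact ⟨fun y => g y ^ k, hg.pow k, fun z hz => by simp only [hfg z hz]⟩

theorem div (h : B.OrderLT n f) (h' : B.OrderLT n f') (h0 : ∀ z ∈ B.carrier, f' z ≠ 0) :
    B.OrderLT n fun z => f z / f' z := by
  obtain ⟨g, hg, hfg⟩ := h
  obtain ⟨g', hg', hfg'⟩ := h'
  refine ⟨fun y => g y / g' y, hg.div hg' fun y hy => ?_,
    fun z hz => by simp only [hfg z hz, hfg' z hz]⟩
  obtain ⟨z, hz, rfl⟩ := exists_proj_eq hy
  rw [← hfg' z hz]
  exact h0 z hz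

theorem sum {ι : Type*} {s : Finset ι} {f : ι → JetPoint → ℝ}
    (h : ∀ k ∈ s, B.OrderLT n (f k)) : B.OrderLT n fun z => ∑ k ∈ s, f k z := by
  choose! g hg hfg using h
  exact ⟨fun y => ∑ k ∈ s, g k y, ContDiffOn.sum hg,
    fun z hz => Finset.sum_congr rfl fun k hk => hfg k hk z hz⟩

theorem coord_u (h : k < n) : B.OrderLT n fun z => z.u k :=
  ⟨fun y => y.2.2 ⟨k, h⟩, ContDiff.contDiffOn (by fun_prop), fun _ _ => rfl⟩

theorem of_contDiffOn {a : ℝ → ℝ → ℝ}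
    (h : ContDiffOn ℝ ∞ (fun y : ℝ × ℝ => a y.1 y.2) (B.I ×ˢ B.J)) :
    B.OrderLT 0 fun z => a z.t z.x :=
  ⟨fun y => a y.1 y.2.1,
    h.comp (f := fun y : ℝ × ℝ × (Fin 0 → ℝ) => (y.1, y.2.1)) (ContDiff.contDiffOn (by fun_prop))
      fun y hy => ⟨hy.1, hy.2.1⟩, fun _ _ => rfl⟩

end OrderLT

theorem hasDerivAt_comp_set_of_eq_comp_proj {g : ℝ × ℝ × (Fin n → ℝ) → ℝ}
    (hg : ContDiffOn ℝ ∞ g (B.finiteBox n)) (hfg : ∀ z ∈ B.carrier, f z = g (proj n z))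
    (i : JetCoord) (hz : z ∈ B.carrier) :
    HasDerivAt (fun s => f (z.set i s)) (fderiv ℝ g (proj n z) (i.dir n)) (z.get i) := by
  have hline : HasDerivAt (fun s => proj n (z.set i s)) (i.dir n) (z.get i) := by
    have hsub : HasDerivAt (fun s => s - z.get i) 1 (z.get i) := (hasDerivAt_id _).sub_const _
    simpa only [JetCoord.proj_set, one_smul] using
      (hsub.smul_const (i.dir n)).const_add (proj n z)
  have hg' : HasFDerivAt g (fderiv ℝ g (proj n z)) (proj n (z.set i (z.get i))) := by
    rw [set_get]
    exact ((hg.contDiffAt ((isOpen_finiteBox n).mem_nhds (proj_mem hz n))).differentiableAt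
      (by simp)).hasFDerivAt
  refine (hg'.comp_hasDerivAt (z.get i) hline).congr_of_eventuallyEq ?_
  exact (eventually_set_mem hz i).mono fun s hs => hfg _ hs

theorem pd_eq_fderiv_of_eq_comp_proj {g : ℝ × ℝ × (Fin n → ℝ) → ℝ}
    (hg : ContDiffOn ℝ ∞ g (B.finiteBox n)) (hfg : ∀ z ∈ B.carrier, f z = g (proj n z))
    (i : JetCoord) (hz : z ∈ B.carrier) : pd i f z = fderiv ℝ g (proj n z) (i.dir n) :=
  (hasDerivAt_comp_set_of_eq_comp_proj hg hfg i hz).deriv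

theorem contDiffOn_fderiv_apply {g : ℝ × ℝ × (Fin n → ℝ) → ℝ}
    (hg : ContDiffOn ℝ ∞ g (B.finiteBox n)) (v : ℝ × ℝ × (Fin n → ℝ)) :
    ContDiffOn ℝ ∞ (fun y => fderiv ℝ g y v) (B.finiteBox n) :=
  ((contDiffOn_infty_iff_fderiv_of_isOpen (isOpen_finiteBox n)).1 hg).2.clm_apply contDiffOn_const

theorem pd_congr (h : EqOn f f' B.carrier) (i : JetCoord) :
    EqOn (pd i f) (pd i f') B.carrier := fun _ hz =>
  EventuallyEq.deriv_eq ((eventually_set_mem hz i).mono fun _ hs => h hs)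

namespace OrderLT

theorem hasDerivAt (h : B.OrderLT n f) (i : JetCoord) (hz : z ∈ B.carrier) :
    HasDerivAt (fun s => f (z.set i s)) (pd i f z) (z.get i) := by
  obtain ⟨g, hg, hfg⟩ := h
  exact (hasDerivAt_comp_set_of_eq_comp_proj hg hfg i hz).differentiableAt.hasDerivAt

theorem hasDerivAt_set (h : B.OrderLT n f) (hz : z ∈ B.carrier) {s : ℝ} (hs : s ∈ B.range i) :
    HasDerivAt (fun s => f (z.set i s)) (pd i f (z.set i s)) s := by
  simpa using h.hasDerivAt i (set_mem hz hs)

protected theorem pd (h : B.OrderLT n f) (i : JetCoord) : B.OrderLT n (pd i f) := by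
  obtain ⟨g, hg, hfg⟩ := h
  exact ⟨fun y => fderiv ℝ g y (i.dir n), contDiffOn_fderiv_apply hg _,
    fun z hz => pd_eq_fderiv_of_eq_comp_proj hg hfg i hz⟩

theorem pd_comm (h : B.OrderLT n f) (i j : JetCoord) (hz : z ∈ B.carrier) :
    pd i (pd j f) z = pd j (pd i f) z := by
  obtain ⟨g, hg, hfg⟩ := h
  have hgz := hg.contDiffAt ((isOpen_finiteBox n).mem_nhds (proj_mem hz n))
  have hfderiv : DifferentiableAt ℝ (fderiv ℝ g) (proj n z) :=
    (hgz.fderiv_right (m := 1) (by norm_cast)).differentiableAt one_ne_zero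
  have hpd_pd (i j : JetCoord) : pd i (pd j f) z =
      fderiv ℝ (fderiv ℝ g) (proj n z) (i.dir n) (j.dir n) := by
    rw [pd_eq_fderiv_of_eq_comp_proj (contDiffOn_fderiv_apply hg (j.dir n))
      (fun z hz => pd_eq_fderiv_of_eq_comp_proj hg hfg j hz) i hz,
      (hfderiv.hasFDerivAt.clm_apply (hasFDerivAt_const (j.dir n) (proj n z))).fderiv]
    simp
  rw [hpd_pd, hpd_pd]
  exact (hgz.isSymmSndFDerivAt (by simp; norm_cast)).eq _ _

theorem pd_u_eq_zero (h : B.OrderLT n f) (hk : n ≤ k) (hz : z ∈ B.carrier) :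
    pd (.u k) f z = 0 := by
  obtain ⟨g, hg, hfg⟩ := h
  rw [pd_eq_fderiv_of_eq_comp_proj hg hfg _ hz, JetCoord.dir_u_of_le hk, map_zero]

theorem apply_set_eq_of_pd_eq_zero (h : B.OrderLT n f) (h0 : ∀ z ∈ B.carrier, pd i f z = 0)
    (hz : z ∈ B.carrier) {a : ℝ} (ha : a ∈ B.range i) : f (z.set i a) = f z := by
  have hderiv (s : ℝ) (hs : s ∈ B.range i) : HasDerivAt (fun s => f (z.set i s)) 0 s := by
    simpa only [h0 _ (set_mem hz hs)] using h.hasDerivAt_set hz hs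
  simpa using (isOpen_range i).is_const_of_deriv_eq_zero (convex_range i).isPreconnected
    (fun s hs => (hderiv s hs).differentiableAt.differentiableWithinAt)
    (fun s hs => (hderiv s hs).deriv) ha (get_mem hz i)

theorem comp_set_u {a : ℝ} (h : B.OrderLT (n + 1) f) (ha : a ∈ B.U n) :
    B.OrderLT n fun z => f (z.set (.u n) a) := by
  obtain ⟨g, hg, hfg⟩ := h
  refine ⟨fun y => g (y.1, y.2.1, Fin.snoc (α := fun _ => ℝ) y.2.2 a),
    hg.comp (ContDiff.contDiffOn ?_) fun y hy => ⟨hy.1, hy.2.1, fun i => ?_⟩,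
    fun z hz => ?_⟩
  · refine contDiff_fst.prodMk ((contDiff_fst.comp contDiff_snd).prodMk (contDiff_pi.2 fun i => ?_))
    cases i using Fin.lastCases with
    | last => simpa only [Fin.snoc_last] using contDiff_const
    | cast j => simp only [Fin.snoc_castSucc]; fun_prop
  · cases i using Fin.lastCases with
    | last => simpa using ha
    | cast j => simpa using hy.2.2 j
  · refine (hfg _ (set_mem (i := .u n) hz ha)).trans
      (congrArg g (Prod.ext rfl (Prod.ext rfl (funext fun i => ?_))))
    cases i using Fin.lastCases with
    | last => simp [proj, JetPoint.set]
    | cast j => simp [proj, JetPoint.set, j.2.ne]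

theorem of_pd_u_eq_zero (h : B.OrderLT (n + 1) f) (h0 : ∀ z ∈ B.carrier, pd (.u n) f z = 0) :
    B.OrderLT n f := by
  obtain ⟨a, ha⟩ := B.nonempty_U n
  exact (h.comp_set_u ha).congr fun z hz => (h.apply_set_eq_of_pd_eq_zero h0 hz ha).symm

theorem comp_set_x (h : B.OrderLT n f) {a : ℝ} (ha : a ∈ B.J) :
    B.OrderLT n fun z => f (z.set .x a) := by
  obtain ⟨g, hg, hfg⟩ := h
  exact ⟨fun y => g (y.1, a, y.2.2), hg.comp (ContDiff.contDiffOn (by fun_prop))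
    fun y hy => ⟨hy.1, ha, hy.2.2⟩, fun z hz => hfg _ (set_mem hz ha)⟩

theorem exists_primitive (h : B.OrderLT n f) (hi : ∀ k, i = .u k → k < n) :
    ∃ G, B.OrderLT n G ∧ ∀ z ∈ B.carrier, pd i G z = f z := by
  obtain ⟨a, ha⟩ := B.nonempty_range i
  obtain ⟨g, hg, hfg⟩ := h
  obtain ⟨ℓ, hℓ, hℓ_dir⟩ := JetCoord.exists_clm_proj_eq_get hi
  have hslice (y) (hy : y ∈ B.finiteBox n) : y + (a - ℓ y) • i.dir n ∈ B.finiteBox n := by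
    obtain ⟨z, hz, rfl⟩ := exists_proj_eq hy
    rw [hℓ, ← JetCoord.proj_set]
    exact proj_mem (set_mem hz ha) n
  obtain ⟨G, hG, hGg⟩ := exists_contDiffOn_fderiv_apply_eq (isOpen_finiteBox n)
    (convex_finiteBox n) hℓ_dir hslice hg
  refine ⟨fun z => G (proj n z), ⟨G, hG, fun _ _ => rfl⟩, fun z hz => ?_⟩
  rw [pd_eq_fderiv_of_eq_comp_proj hG (fun _ _ => rfl) i hz, hGg _ (proj_mem hz n), hfg z hz]

end OrderLT

end JetBox

/-! ### Total derivatives -/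

namespace JetBox

variable {B : JetBox} {n m N k : ℕ} {f f' F : JetPoint → ℝ} {z : JetPoint} {i : JetCoord}
  {c : ℕ → JetPoint → ℝ}

theorem evol_congr (h : EqOn f f' B.carrier) : EqOn (evol i c f) (evol i c f') B.carrier :=
  fun z hz => by simp only [evol, pd_congr h _ hz]

theorem totalDx_congr (h : EqOn f f' B.carrier) : EqOn (totalDx f) (totalDx f') B.carrier := by
  rw [totalDx_eq_evol]
  exact evol_congr h

theorem totalDt_congr (h : EqOn f f' B.carrier) :
    EqOn (totalDt F f) (totalDt F f') B.carrier := by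
  rw [totalDt_eq_evol]
  exact evol_congr h

theorem totalDx_eq_zero (h : ∀ z ∈ B.carrier, f z = 0) (hz : z ∈ B.carrier) : totalDx f z = 0 := by
  rw [totalDx_congr (f' := fun _ => 0) h hz, totalDx_eq_evol, evol_const]

namespace OrderLT

theorem pd_add (h : B.OrderLT n f) (h' : B.OrderLT m f') (i : JetCoord) (hz : z ∈ B.carrier) :
    pd i (fun z => f z + f' z) z = pd i f z + pd i f' z :=
  ((h.hasDerivAt i hz).add (h'.hasDerivAt i hz)).deriv

theorem pd_sub (h : B.OrderLT n f) (h' : B.OrderLT m f') (i : JetCoord) (hz : z ∈ B.carrier) :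
    pd i (fun z => f z - f' z) z = pd i f z - pd i f' z :=
  ((h.hasDerivAt i hz).sub (h'.hasDerivAt i hz)).deriv

theorem pd_mul (h : B.OrderLT n f) (h' : B.OrderLT m f') (i : JetCoord) (hz : z ∈ B.carrier) :
    pd i (fun z => f z * f' z) z = pd i f z * f' z + f z * pd i f' z := by
  have hmul := (h.hasDerivAt i hz).fun_mul (h'.hasDerivAt i hz)
  rw [set_get] at hmul
  exact hmul.deriv

theorem pd_div (h : B.OrderLT n f) (h' : B.OrderLT m f') (i : JetCoord) (hz : z ∈ B.carrier)
    (h0 : f' z ≠ 0) :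
    pd i (fun z => f z / f' z) z = (pd i f z * f' z - f z * pd i f' z) / f' z ^ 2 := by
  have hdiv := (h.hasDerivAt i hz).fun_div (h'.hasDerivAt i hz) (by simpa using h0)
  rw [set_get] at hdiv
  exact hdiv.deriv

theorem pd_sum {ι : Type*} {s : Finset ι} {f : ι → JetPoint → ℝ}
    (h : ∀ k ∈ s, B.OrderLT n (f k)) (i : JetCoord) (hz : z ∈ B.carrier) :
    pd i (fun z => ∑ k ∈ s, f k z) z = ∑ k ∈ s, pd i (f k) z :=
  (HasDerivAt.fun_sum fun k hk => (h k hk).hasDerivAt i hz).deriv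

theorem evol_eq (h : B.OrderLT n f) (hN : n ≤ N) (hz : z ∈ B.carrier) :
    evol i c f z = pd i f z + ∑ k ∈ Finset.range N, c k z * pd (.u k) f z := by
  rw [evol, finsum_eq_sum_of_support_subset]
  intro k hk
  by_contra hkN
  have hNk : N ≤ k := by simpa using hkN
  exact hk (by simp only [h.pd_u_eq_zero (hN.trans hNk) hz, mul_zero])

theorem evol_add (h : B.OrderLT n f) (h' : B.OrderLT m f') (hz : z ∈ B.carrier) :
    evol i c (fun z => f z + f' z) z = evol i c f z + evol i c f' z := by
  have hn := le_max_left n m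
  have hm := le_max_right n m
  rw [((h.mono hn).add (h'.mono hm)).evol_eq le_rfl hz, h.evol_eq hn hz, h'.evol_eq hm hz]
  simp only [h.pd_add h' _ hz, mul_add, Finset.sum_add_distrib]
  ring

theorem evol_sub (h : B.OrderLT n f) (h' : B.OrderLT m f') (hz : z ∈ B.carrier) :
    evol i c (fun z => f z - f' z) z = evol i c f z - evol i c f' z := by
  have hadd := h.evol_add (i := i) (c := c) ((const m (-1)).mul h') hz
  rw [evol_const_mul] at hadd
  simpa only [neg_one_mul, ← sub_eq_add_neg] using hadd

theorem evol_mul (h : B.OrderLT n f) (h' : B.OrderLT m f') (hz : z ∈ B.carrier) :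
    evol i c (fun z => f z * f' z) z = evol i c f z * f' z + f z * evol i c f' z := by
  have hn := le_max_left n m
  have hm := le_max_right n m
  rw [((h.mono hn).mul (h'.mono hm)).evol_eq le_rfl hz, h.evol_eq hn hz, h'.evol_eq hm hz]
  simp only [h.pd_mul h' _ hz, mul_add, add_mul, Finset.sum_add_distrib, Finset.mul_sum,
    Finset.sum_mul, mul_assoc, mul_left_comm (f z)]
  ring

theorem evol_sum {ι : Type*} {s : Finset ι} {f : ι → JetPoint → ℝ}
    (h : ∀ k ∈ s, B.OrderLT n (f k)) (hz : z ∈ B.carrier) :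
    evol i c (fun z => ∑ k ∈ s, f k z) z = ∑ k ∈ s, evol i c (f k) z := by
  rw [(OrderLT.sum h).evol_eq le_rfl hz, pd_sum h i hz]
  simp only [pd_sum h _ hz, Finset.mul_sum]
  rw [Finset.sum_comm, ← Finset.sum_add_distrib]
  exact Finset.sum_congr rfl fun k hk => ((h k hk).evol_eq le_rfl hz).symm

protected theorem evol (h : B.OrderLT n f) (hN : n ≤ N) (hc : ∀ k < n, B.OrderLT N (c k)) :
    B.OrderLT N (evol i c f) := by
  have hterm (k) (hk : k ∈ Finset.range n) : B.OrderLT N fun z => c k z * pd (.u k) f z :=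
    (hc k (Finset.mem_range.1 hk)).mul ((h.pd _).mono hN)
  exact (((h.pd i).mono hN).add (OrderLT.sum hterm)).congr fun z hz => h.evol_eq le_rfl hz

theorem totalDx_eq (h : B.OrderLT n f) (hN : n ≤ N) (hz : z ∈ B.carrier) :
    totalDx f z = pd .x f z + ∑ k ∈ Finset.range N, z.u (k + 1) * pd (.u k) f z := by
  rw [totalDx_eq_evol]
  exact h.evol_eq hN hz

theorem totalDt_eq (h : B.OrderLT n f) (hN : n ≤ N) (hz : z ∈ B.carrier) :
    totalDt F f z = pd .t f z + ∑ k ∈ Finset.range N, (totalDx^[k] F) z * pd (.u k) f z := by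
  rw [totalDt_eq_evol]
  exact h.evol_eq hN hz

theorem totalDx_eq_pd (h : B.OrderLT 0 f) (hz : z ∈ B.carrier) : totalDx f z = pd .x f z := by
  simpa using h.totalDx_eq le_rfl hz

theorem totalDx_add (h : B.OrderLT n f) (h' : B.OrderLT m f') (hz : z ∈ B.carrier) :
    totalDx (fun z => f z + f' z) z = totalDx f z + totalDx f' z := by
  rw [totalDx_eq_evol]
  exact h.evol_add h' hz

theorem totalDx_sub (h : B.OrderLT n f) (h' : B.OrderLT m f') (hz : z ∈ B.carrier) :
    totalDx (fun z => f z - f' z) z = totalDx f z - totalDx f' z := by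
  rw [totalDx_eq_evol]
  exact h.evol_sub h' hz

theorem totalDt_add (h : B.OrderLT n f) (h' : B.OrderLT m f') (hz : z ∈ B.carrier) :
    totalDt F (fun z => f z + f' z) z = totalDt F f z + totalDt F f' z := by
  rw [totalDt_eq_evol]
  exact h.evol_add h' hz

theorem totalDt_sub (h : B.OrderLT n f) (h' : B.OrderLT m f') (hz : z ∈ B.carrier) :
    totalDt F (fun z => f z - f' z) z = totalDt F f z - totalDt F f' z := by
  rw [totalDt_eq_evol]
  exact h.evol_sub h' hz

theorem totalDx_mul (h : B.OrderLT n f) (h' : B.OrderLT m f') (hz : z ∈ B.carrier) :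
    totalDx (fun z => f z * f' z) z = totalDx f z * f' z + f z * totalDx f' z := by
  rw [totalDx_eq_evol]
  exact h.evol_mul h' hz

theorem totalDx_sum {ι : Type*} {s : Finset ι} {f : ι → JetPoint → ℝ}
    (h : ∀ k ∈ s, B.OrderLT n (f k)) (hz : z ∈ B.carrier) :
    totalDx (fun z => ∑ k ∈ s, f k z) z = ∑ k ∈ s, totalDx (f k) z := by
  rw [totalDx_eq_evol]
  exact evol_sum h hz

protected theorem totalDx (h : B.OrderLT n f) : B.OrderLT (n + 1) (totalDx f) :=
  OrderLT.evol (i := .x) h n.le_succ fun _ hk => coord_u (Nat.succ_lt_succ hk)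

theorem iterate_totalDx (h : B.OrderLT n f) (k : ℕ) : B.OrderLT (n + k) (totalDx^[k] f) := by
  induction k with
  | zero => exact h
  | succ k ih =>
    rw [Function.iterate_succ_apply']
    exact ih.totalDx

protected theorem totalDt (hF : B.OrderLT m F) (h : B.OrderLT n f) :
    B.OrderLT (m + n) (totalDt F f) :=
  OrderLT.evol (i := .t) h (Nat.le_add_left n m) fun k hk =>
    (hF.iterate_totalDx k).mono (Nat.add_le_add_left hk.le m)

theorem pd_totalDx (h : B.OrderLT n f) (i : JetCoord) (hN : n ≤ N) (hz : z ∈ B.carrier) :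
    pd i (totalDx f) z = totalDx (pd i f) z +
      ∑ k ∈ Finset.range N, pd i (fun z => z.u (k + 1)) z * pd (.u k) f z := by
  have hu (k) (hk : k ∈ Finset.range N) : B.OrderLT (N + 1) fun z => z.u (k + 1) :=
    coord_u (Nat.succ_lt_succ (Finset.mem_range.1 hk))
  have hterm (k) (hk : k ∈ Finset.range N) :
      B.OrderLT (N + 1) fun z => z.u (k + 1) * pd (.u k) f z :=
    (hu k hk).mul ((h.mono (hN.trans N.le_succ)).pd _)
  rw [pd_congr (fun z hz => h.totalDx_eq hN hz) i hz, (h.pd _).pd_add (OrderLT.sum hterm) i hz,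
    pd_sum hterm i hz, (h.pd i).totalDx_eq hN hz, h.pd_comm i .x hz, add_assoc,
    ← Finset.sum_add_distrib]
  refine congrArg _ (Finset.sum_congr rfl fun k hk => ?_)
  rw [(hu k hk).pd_mul (h.pd _) i hz, h.pd_comm i _ hz, add_comm]

theorem pd_u_succ_totalDx (h : B.OrderLT n f) (k : ℕ) (hz : z ∈ B.carrier) :
    pd (.u (k + 1)) (totalDx f) z = totalDx (pd (.u (k + 1)) f) z + pd (.u k) f z := by
  have hself : pd (.u (k + 1)) (fun z => z.u (k + 1)) z = 1 := pd_get_self (.u (k + 1)) z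
  rw [h.pd_totalDx _ (le_max_left n (k + 1)) hz,
    Finset.sum_eq_single_of_mem k (by simp) fun j _ hj => ?_, hself, one_mul]
  have hne : pd (.u (k + 1)) (fun z => z.u (j + 1)) z = 0 :=
    pd_get_of_ne (j := .u (j + 1)) (by simpa using hj) z
  rw [hne, zero_mul]

theorem pd_totalDx_of_ne (h : B.OrderLT n f) (hi : ∀ k, i ≠ .u (k + 1)) (hz : z ∈ B.carrier) :
    pd i (totalDx f) z = totalDx (pd i f) z := by
  have hne (k : ℕ) : pd i (fun z => z.u (k + 1)) z = 0 :=
    pd_get_of_ne (j := .u (k + 1)) (hi k).symm z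
  simp [h.pd_totalDx i le_rfl hz, hne]

theorem pd_top_totalDx (h : B.OrderLT (n + 1) f) (hz : z ∈ B.carrier) :
    pd (.u (n + 1)) (totalDx f) z = pd (.u n) f z := by
  rw [h.pd_u_succ_totalDx n hz, totalDx_eq_zero (fun z hz => h.pd_u_eq_zero le_rfl hz) hz,
    zero_add]

theorem totalDx_totalDt_comm (hF : B.OrderLT m F) (h : B.OrderLT n f) (hz : z ∈ B.carrier) :
    totalDx (totalDt F f) z = totalDt F (totalDx f) z := by
  have hterm (k) (hk : k ∈ Finset.range n) :
      B.OrderLT (m + n) fun z => (totalDx^[k] F) z * pd (.u k) f z :=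
    ((hF.iterate_totalDx k).mono (Nat.add_le_add_left (Finset.mem_range.1 hk).le m)).mul
      ((h.pd _).mono (Nat.le_add_left n m))
  have hleibniz (k) : totalDx (fun z => (totalDx^[k] F) z * pd (.u k) f z) z =
      (totalDx^[k + 1] F) z * pd (.u k) f z + (totalDx^[k] F) z * totalDx (pd (.u k) f) z := by
    rw [(hF.iterate_totalDx k).totalDx_mul (h.pd _) hz, Function.iterate_succ_apply']
  have htop : totalDx (pd (.u n) f) z = 0 :=
    totalDx_eq_zero (fun z hz => h.pd_u_eq_zero le_rfl hz) hz
  rw [totalDx_congr (fun z hz => h.totalDt_eq le_rfl hz) hz,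
    (h.pd _).totalDx_add (OrderLT.sum hterm) hz, totalDx_sum hterm hz,
    h.totalDx.totalDt_eq le_rfl hz,
    h.pd_totalDx_of_ne (by simp) hz, Finset.sum_range_succ', h.pd_totalDx_of_ne (by simp) hz]
  have hshift := Finset.sum_range_succ' (fun k => (totalDx^[k] F) z * totalDx (pd (.u k) f) z) n
  rw [Finset.sum_range_succ, htop, mul_zero, add_zero] at hshift
  simp only [hleibniz, h.pd_u_succ_totalDx _ hz, mul_add, Finset.sum_add_distrib, hshift]
  ring

theorem of_totalDx (h : B.OrderLT m f) (h' : B.OrderLT (n + 1) (totalDx f)) : B.OrderLT n f := by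
  induction m with
  | zero => exact h.mono n.zero_le
  | succ m ih =>
    rcases le_or_gt n m with hnm | hmn
    · exact ih (h.of_pd_u_eq_zero fun z hz =>
        (h.pd_top_totalDx hz).symm.trans (h'.pd_u_eq_zero (Nat.succ_le_succ hnm) hz))
    · exact h.mono hmn

end OrderLT

/-! ### Conservation laws -/

variable {ρ σ ρ' σ' : JetPoint → ℝ}

theorem IsDifferentialFunction.add (h : B.IsDifferentialFunction f)
    (h' : B.IsDifferentialFunction f') : B.IsDifferentialFunction fun z => f z + f' z := by
  obtain ⟨n, hf⟩ := isDifferentialFunction_iff.1 h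
  obtain ⟨m, hf'⟩ := isDifferentialFunction_iff.1 h'
  exact ((hf.mono (le_max_left n m)).add (hf'.mono (le_max_right n m))).isDifferentialFunction

theorem IsDifferentialFunction.const_mul (h : B.IsDifferentialFunction f) (c : ℝ) :
    B.IsDifferentialFunction fun z => c * f z := by
  obtain ⟨n, hf⟩ := isDifferentialFunction_iff.1 h
  exact ((OrderLT.const n c).mul hf).isDifferentialFunction

theorem IsDifferentialFunction.sub (h : B.IsDifferentialFunction f)
    (h' : B.IsDifferentialFunction f') : B.IsDifferentialFunction fun z => f z - f' z := by
  simpa only [neg_one_mul, ← sub_eq_add_neg] using h.add (h'.const_mul (-1))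

theorem IsConservationLaw.sub (h : B.IsConservationLaw F ρ σ) (h' : B.IsConservationLaw F ρ' σ') :
    B.IsConservationLaw F (fun z => ρ z - ρ' z) (fun z => σ z - σ' z) := by
  refine ⟨h.density.sub h'.density, h.flux.sub h'.flux, fun z hz => ?_⟩
  obtain ⟨_, hρ⟩ := isDifferentialFunction_iff.1 h.density
  obtain ⟨_, hρ'⟩ := isDifferentialFunction_iff.1 h'.density
  obtain ⟨_, hσ⟩ := isDifferentialFunction_iff.1 h.flux
  obtain ⟨_, hσ'⟩ := isDifferentialFunction_iff.1 h'.flux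
  rw [hρ.totalDt_sub hρ' hz, hσ.totalDx_sub hσ' hz, h.law z hz, h'.law z hz]

theorem IsConservationLaw.congr (h : B.IsConservationLaw F ρ σ) (hρ : EqOn ρ' ρ B.carrier)
    (hσ : EqOn σ' σ B.carrier) : B.IsConservationLaw F ρ' σ' := by
  obtain ⟨_, hρ_order⟩ := isDifferentialFunction_iff.1 h.density
  obtain ⟨_, hσ_order⟩ := isDifferentialFunction_iff.1 h.flux
  refine ⟨(hρ_order.congr hρ).isDifferentialFunction, (hσ_order.congr hσ).isDifferentialFunction,
    fun z hz => ?_⟩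
  rw [totalDt_congr hρ hz, totalDx_congr hσ hz, h.law z hz]

theorem IsConservationLaw.const_mul (h : B.IsConservationLaw F ρ σ) (c : ℝ) :
    B.IsConservationLaw F (fun z => c * ρ z) (fun z => c * σ z) :=
  ⟨h.density.const_mul c, h.flux.const_mul c, fun z hz => by
    rw [totalDt_const_mul, totalDx_const_mul, h.law z hz]⟩

theorem IsConservationLaw.sub_totalDx (hF : B.OrderLT m F) (h : B.IsConservationLaw F ρ σ)
    (hf : B.OrderLT n f) :
    B.IsConservationLaw F (fun z => ρ z - totalDx f z) (fun z => σ z - totalDt F f z) :=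
  h.sub ⟨hf.totalDx.isDifferentialFunction, (hF.totalDt hf).isDifferentialFunction,
    fun _ hz => (hF.totalDx_totalDt_comm hf hz).symm⟩

theorem OrderLT.exists_totalDx_eq_zero_and_totalDt_eq (h : B.OrderLT n f)
    (h0 : ∀ z ∈ B.carrier, totalDx f z = 0) :
    ∃ S, B.OrderLT 0 S ∧ ∀ z ∈ B.carrier, totalDx S z = 0 ∧ totalDt F S z = f z := by
  have hf : B.OrderLT 0 f := h.of_totalDx ((OrderLT.const 1 0).congr h0)
  have hfx (z) (hz : z ∈ B.carrier) : pd .x f z = 0 := (hf.totalDx_eq_pd hz).symm.trans (h0 z hz)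
  obtain ⟨G, hG, hGf⟩ := hf.exists_primitive (i := .t) (by simp)
  obtain ⟨a, ha⟩ := B.nonempty_J
  have hS := hG.comp_set_x ha
  refine ⟨fun z => G (z.set .x a), hS, fun z hz => ⟨?_, ?_⟩⟩
  · rw [hS.totalDx_eq_pd hz]
    simp [pd]
  · have hSt : pd .t (fun z => G (z.set .x a)) z = pd .t G (z.set .x a) := rfl
    rw [hS.totalDt_eq le_rfl hz, hSt, hGf _ (set_mem hz ha),
      hf.apply_set_eq_of_pd_eq_zero hfx hz ha, Finset.sum_range_zero, add_zero]

theorem IsConservationLaw.isTrivialLaw (hF : B.OrderLT m F) (h : B.IsConservationLaw F ρ σ)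
    (hf : B.OrderLT n f) (hρ : ∀ z ∈ B.carrier, ρ z = totalDx f z) : B.IsTrivialLaw F ρ σ := by
  have hsub := h.sub_totalDx hF hf
  have hflux (z) (hz : z ∈ B.carrier) : totalDx (fun z => σ z - totalDt F f z) z = 0 := by
    rw [← hsub.law z hz, totalDt_congr (f' := fun _ => 0) (fun z hz => sub_eq_zero.2 (hρ z hz)) hz,
      totalDt_eq_evol, evol_const]
  obtain ⟨_, hτ⟩ := isDifferentialFunction_iff.1 hsub.flux
  obtain ⟨S, hS, hDS⟩ := hτ.exists_totalDx_eq_zero_and_totalDt_eq (F := F) hflux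
  refine ⟨fun z => f z + S z, hf.isDifferentialFunction.add hS.isDifferentialFunction,
    fun z hz => ⟨?_, ?_⟩⟩
  · rw [hf.totalDx_add hS hz, (hDS z hz).1, hρ z hz, add_zero]
  · rw [hf.totalDt_add hS hz, (hDS z hz).2, add_sub_cancel]

theorem IsTrivialLaw.sub (h : B.IsTrivialLaw F ρ σ) (h' : B.IsTrivialLaw F ρ' σ') :
    B.IsTrivialLaw F (fun z => ρ z - ρ' z) (fun z => σ z - σ' z) := by
  obtain ⟨f, hf, hfeq⟩ := h
  obtain ⟨f', hf', hfeq'⟩ := h'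
  refine ⟨fun z => f z - f' z, hf.sub hf', fun z hz => ?_⟩
  obtain ⟨_, hf⟩ := isDifferentialFunction_iff.1 hf
  obtain ⟨_, hf'⟩ := isDifferentialFunction_iff.1 hf'
  beta_reduce
  rw [hf.totalDx_sub hf' hz, hf.totalDt_sub hf' hz, (hfeq z hz).1, (hfeq z hz).2,
    (hfeq' z hz).1, (hfeq' z hz).2]
  exact ⟨rfl, rfl⟩

theorem IsTrivialLaw.congr (h : B.IsTrivialLaw F ρ σ) (hρ : EqOn ρ' ρ B.carrier)
    (hσ : EqOn σ' σ B.carrier) : B.IsTrivialLaw F ρ' σ' := by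
  obtain ⟨f, hf, hfeq⟩ := h
  exact ⟨f, hf, fun z hz => by rw [hρ hz, hσ hz]; exact hfeq z hz⟩

namespace OrderLT

theorem pd_pd_add (h : B.OrderLT n f) (h' : B.OrderLT m f') (i : JetCoord) (hz : z ∈ B.carrier) :
    pd i (pd i fun z => f z + f' z) z = pd i (pd i f) z + pd i (pd i f') z := by
  rw [pd_congr (fun z hz => h.pd_add h' i hz) i hz, (h.pd i).pd_add (h'.pd i) i hz]

theorem pd_pd_sum {ι : Type*} {s : Finset ι} {f : ι → JetPoint → ℝ}
    (h : ∀ k ∈ s, B.OrderLT n (f k)) (i : JetCoord) (hz : z ∈ B.carrier) :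
    pd i (pd i fun z => ∑ k ∈ s, f k z) z = ∑ k ∈ s, pd i (pd i (f k)) z := by
  rw [pd_congr (fun z hz => pd_sum h i hz) i hz, pd_sum (fun k hk => (h k hk).pd i) i hz]

theorem pd_pd_mul (h : B.OrderLT n f) (h' : B.OrderLT n f') (i : JetCoord) (hz : z ∈ B.carrier) :
    pd i (pd i fun z => f z * f' z) z =
      pd i (pd i f) z * f' z + 2 * (pd i f z * pd i f' z) + f z * pd i (pd i f') z := by
  rw [pd_congr (fun z hz => h.pd_mul h' i hz) i hz,
    ((h.pd i).mul h').pd_add (h.mul (h'.pd i)) i hz, (h.pd i).pd_mul h' i hz,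
    h.pd_mul (h'.pd i) i hz]
  ring

theorem pd_pd_top_totalDx (h : B.OrderLT (n + 1) f) (hz : z ∈ B.carrier) :
    pd (.u (n + 1)) (pd (.u (n + 1)) (totalDx f)) z = 0 := by
  rw [pd_congr (fun z hz => h.pd_top_totalDx hz) _ hz]
  exact (h.pd _).pd_u_eq_zero le_rfl hz

theorem pd_top_iterate_totalDx (h : B.OrderLT (n + 1) f) (k : ℕ) (hz : z ∈ B.carrier) :
    pd (.u (k + n)) (totalDx^[k] f) z = pd (.u n) f z := by
  induction k generalizing z with
  | zero => rw [Nat.zero_add, Function.iterate_zero_apply]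
  | succ k ih =>
    have hk : B.OrderLT (k + n + 1) (totalDx^[k] f) := (h.iterate_totalDx k).mono (by omega)
    rw [Function.iterate_succ_apply', Nat.succ_add, hk.pd_top_totalDx hz, ih hz]

end OrderLT

/-- `u_t = F` is a quasilinear evolution equation of order two: `F` is affine in `u_xx`, with a
nowhere vanishing coefficient `∂F/∂u_xx`. -/
structure IsQuasilinear (B : JetBox) (F : JetPoint → ℝ) : Prop where
  orderLT : B.OrderLT 3 F
  orderLT_pd : B.OrderLT 2 (pd (.u 2) F)
  pd_ne_zero : ∀ z ∈ B.carrier, pd (.u 2) F z ≠ 0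

theorem IsQuasilinear.pd_pd_iterate_totalDx (hF : B.IsQuasilinear F) {j : ℕ} (hj : j ≤ k)
    (hz : z ∈ B.carrier) : pd (.u (k + 2)) (pd (.u (k + 2)) (totalDx^[j] F)) z = 0 := by
  rcases hj.lt_or_eq with hjk | rfl
  · exact ((hF.orderLT.iterate_totalDx j).pd _).pd_u_eq_zero (by omega) hz
  · rw [pd_congr (fun z hz => hF.orderLT.pd_top_iterate_totalDx j hz) _ hz]
    exact hF.orderLT_pd.pd_u_eq_zero (Nat.le_add_left 2 j) hz

theorem IsQuasilinear.pd_pd_iterate_totalDx_mul (hF : B.IsQuasilinear F) {j : ℕ} (hj : j ≤ k)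
    (hf : B.OrderLT (k + 2) f) (hz : z ∈ B.carrier) :
    pd (.u (k + 2)) (pd (.u (k + 2)) fun z => (totalDx^[j] F) z * f z) z = 0 := by
  have hF_iter : B.OrderLT (k + 3) (totalDx^[j] F) :=
    (hF.orderLT.iterate_totalDx j).mono (by omega)
  rw [hF_iter.pd_pd_mul (hf.mono (k + 2).le_succ) _ hz, hF.pd_pd_iterate_totalDx hj hz,
    hf.pd_u_eq_zero le_rfl hz, (hf.pd _).pd_u_eq_zero le_rfl hz]
  ring

namespace IsConservationLaw

theorem exists_flux_orderLT (hF : B.OrderLT 3 F) (h : B.IsConservationLaw F ρ σ)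
    (hρ : B.OrderLT (k + 2) ρ) : ∃ τ, B.OrderLT (k + 2) τ ∧ ∀ z ∈ B.carrier,
      pd .t ρ z + ∑ j ∈ Finset.range (k + 1), (totalDx^[j] F) z * pd (.u j) ρ z =
        totalDx τ z + totalDx (pd (.u (k + 1)) ρ) z * (totalDx^[k] F) z := by
  obtain ⟨m, hσ⟩ := isDifferentialFunction_iff.1 h.flux
  have hρ_top := hρ.pd (.u (k + 1))
  have hF_iter : B.OrderLT (k + 3) (totalDx^[k] F) :=
    (hF.iterate_totalDx k).mono (Nat.add_comm 3 k).le
  have hprod := (hρ_top.mono (k + 2).le_succ).mul hF_iter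
  have hterm (j) (hj : j ∈ Finset.range (k + 1)) :
      B.OrderLT (k + 3) fun z => (totalDx^[j] F) z * pd (.u j) ρ z :=
    ((hF.iterate_totalDx j).mono (by have := Finset.mem_range.1 hj; omega)).mul
      ((hρ.pd _).mono (k + 2).le_succ)
  have heq (z) (hz : z ∈ B.carrier) :
      totalDx (fun z => σ z - pd (.u (k + 1)) ρ z * (totalDx^[k] F) z) z =
        pd .t ρ z + ∑ j ∈ Finset.range (k + 1), (totalDx^[j] F) z * pd (.u j) ρ z
          - totalDx (pd (.u (k + 1)) ρ) z * (totalDx^[k] F) z := by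
    rw [hσ.totalDx_sub hprod hz, hρ_top.totalDx_mul hF_iter hz, ← h.law z hz,
      hρ.totalDt_eq le_rfl hz, Finset.sum_range_succ _ (k + 1), Function.iterate_succ_apply']
    ring
  have hflux := (hσ.mono (le_max_left m (k + 3))).sub (hprod.mono (le_max_right m (k + 3)))
  refine ⟨_, hflux.of_totalDx (OrderLT.congr ?_ heq), fun z hz => by rw [heq z hz]; ring⟩
  exact (((hρ.pd _).mono (k + 2).le_succ).add (OrderLT.sum hterm)).sub (hρ_top.totalDx.mul hF_iter)

theorem pd_pd_density_eq_zero (hF : B.IsQuasilinear F) (h : B.IsConservationLaw F ρ σ)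
    (hρ : B.OrderLT (k + 2) ρ) (hz : z ∈ B.carrier) :
    pd (.u (k + 1)) (pd (.u (k + 1)) ρ) z = 0 := by
  obtain ⟨τ, hτ, heq⟩ := h.exists_flux_orderLT hF.orderLT hρ
  have hρ_top := hρ.pd (.u (k + 1))
  have hF_iter (j) (hj : j ≤ k) : B.OrderLT (k + 3) (totalDx^[j] F) :=
    (hF.orderLT.iterate_totalDx j).mono (by omega)
  have hterm (j) (hj : j ∈ Finset.range (k + 1)) :
      B.OrderLT (k + 3) fun z => (totalDx^[j] F) z * pd (.u j) ρ z :=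
    (hF_iter j (Finset.mem_range_succ_iff.1 hj)).mul ((hρ.pd _).mono (k + 2).le_succ)
  have hleft : pd (.u (k + 2)) (pd (.u (k + 2)) fun z => pd .t ρ z +
      ∑ j ∈ Finset.range (k + 1), (totalDx^[j] F) z * pd (.u j) ρ z) z = 0 := by
    rw [(hρ.pd _).pd_pd_add (OrderLT.sum hterm) _ hz, OrderLT.pd_pd_sum hterm _ hz,
      ((hρ.pd _).pd _).pd_u_eq_zero le_rfl hz, zero_add]
    exact Finset.sum_eq_zero fun j hj =>
      hF.pd_pd_iterate_totalDx_mul (Finset.mem_range_succ_iff.1 hj) (hρ.pd _) hz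
  rw [pd_congr (pd_congr heq _) _ hz,
    hτ.totalDx.pd_pd_add (hρ_top.totalDx.mul (hF_iter k le_rfl)) _ hz,
    hρ_top.totalDx.pd_pd_mul (hF_iter k le_rfl) _ hz, hτ.pd_pd_top_totalDx hz,
    hρ_top.pd_pd_top_totalDx hz, hρ_top.pd_top_totalDx hz,
    hF.orderLT.pd_top_iterate_totalDx k hz, hF.pd_pd_iterate_totalDx le_rfl hz] at hleft
  have hmul : pd (.u (k + 1)) (pd (.u (k + 1)) ρ) z * pd (.u 2) F z = 0 := by
    linear_combination hleft / 2
  exact (mul_eq_zero.1 hmul).resolve_right (hF.pd_ne_zero z hz)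

theorem exists_orderLT_sub_totalDx (hF : B.IsQuasilinear F) (h : B.IsConservationLaw F ρ σ)
    (hρ : B.OrderLT (k + 2) ρ) :
    ∃ G, B.OrderLT (k + 1) G ∧ B.OrderLT (k + 1) fun z => ρ z - totalDx G z := by
  have hρ_top : B.OrderLT (k + 1) (pd (.u (k + 1)) ρ) :=
    (hρ.pd _).of_pd_u_eq_zero fun z hz => h.pd_pd_density_eq_zero hF hρ hz
  obtain ⟨G, hG, hGρ⟩ := hρ_top.exists_primitive (i := .u k) (by simp)
  refine ⟨G, hG, (hρ.sub hG.totalDx).of_pd_u_eq_zero fun z hz => ?_⟩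
  rw [hρ.pd_sub hG.totalDx _ hz, hG.pd_top_totalDx hz, hGρ z hz, sub_self]

theorem exists_orderLT_one_sub_totalDx (hF : B.IsQuasilinear F) (h : B.IsConservationLaw F ρ σ) :
    ∃ n G, B.OrderLT n G ∧ B.OrderLT 1 fun z => ρ z - totalDx G z := by
  obtain ⟨k, hρ⟩ : ∃ k, B.OrderLT (k + 1) ρ := by
    obtain ⟨n, hρ⟩ := isDifferentialFunction_iff.1 h.density
    exact ⟨n, hρ.mono n.le_succ⟩
  induction k generalizing ρ σ with
  | zero =>
    refine ⟨0, fun _ => 0, OrderLT.const 0 0, hρ.congr fun z _ => ?_⟩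
    simp only [totalDx_eq_evol, evol_const, sub_zero]
  | succ k ih =>
    obtain ⟨G, hG, hρG⟩ := h.exists_orderLT_sub_totalDx hF hρ
    obtain ⟨n, G', hG', hρG'⟩ := ih (h.sub_totalDx hF.orderLT hG) hρG
    refine ⟨_, fun z => G z + G' z, (hG.mono (le_max_left (k + 1) n)).add
      (hG'.mono (le_max_right (k + 1) n)), hρG'.congr fun z hz => ?_⟩
    beta_reduce
    rw [hG.totalDx_add hG' hz, sub_sub]

end IsConservationLaw

/-! ### The determining equations -/

section Coefficients

variable {a b c : JetPoint → ℝ}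

theorem OrderLT.affine_coeff_eq_zero (ha : B.OrderLT k a) (hb : B.OrderLT k b)
    (h : ∀ z ∈ B.carrier, a z + b z * z.u k = 0) (hz : z ∈ B.carrier) : a z = 0 ∧ b z = 0 := by
  have hu : B.OrderLT (k + 1) fun z => z.u k := coord_u k.lt_succ_self
  have hself : pd (.u k) (fun z => z.u k) z = 1 := pd_get_self (.u k) z
  have hderiv : pd (.u k) (fun z => a z + b z * z.u k) z = b z := by
    rw [ha.pd_add ((hb.mono k.le_succ).mul hu) _ hz, hb.pd_mul hu _ hz, ha.pd_u_eq_zero le_rfl hz,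
      hb.pd_u_eq_zero le_rfl hz, hself]
    ring
  have hb0 : b z = 0 := by
    rw [← hderiv, pd_congr (f' := fun _ => 0) h _ hz, pd_const]
  exact ⟨by simpa [hb0] using h z hz, hb0⟩

theorem OrderLT.quadratic_coeff_eq_zero (ha : B.OrderLT k a) (hb : B.OrderLT k b)
    (hc : B.OrderLT k c) (h : ∀ z ∈ B.carrier, a z + b z * z.u k + c z * z.u k ^ 2 = 0)
    (hz : z ∈ B.carrier) : a z = 0 ∧ b z = 0 ∧ c z = 0 := by
  have hu : B.OrderLT (k + 1) fun z => z.u k := coord_u k.lt_succ_self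
  have hself (z) : pd (.u k) (fun z => z.u k) z = 1 := pd_get_self (.u k) z
  have hcu : B.OrderLT (k + 1) fun z => b z + c z * z.u k :=
    (hb.mono k.le_succ).add ((hc.mono k.le_succ).mul hu)
  have hderiv (z) (hz : z ∈ B.carrier) :
      pd (.u k) (fun z => a z + (b z + c z * z.u k) * z.u k) z = b z + 2 * c z * z.u k := by
    rw [ha.pd_add (hcu.mul hu) _ hz, hcu.pd_mul hu _ hz,
      hb.pd_add ((hc.mono k.le_succ).mul hu) _ hz, hc.pd_mul hu _ hz, ha.pd_u_eq_zero le_rfl hz,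
      hb.pd_u_eq_zero le_rfl hz, hc.pd_u_eq_zero le_rfl hz, hself]
    ring
  have h' (z) (hz : z ∈ B.carrier) : a z + (b z + c z * z.u k) * z.u k = 0 := by
    linear_combination h z hz
  obtain ⟨hb0, hc0⟩ := hb.affine_coeff_eq_zero ((OrderLT.const k 2).mul hc) (fun z hz => by
    rw [← hderiv z hz, pd_congr (f' := fun _ => 0) h' _ hz, pd_const]) hz
  have hc0 : c z = 0 := by simpa using hc0
  exact ⟨by simpa [hb0, hc0] using h z hz, hb0, hc0⟩

theorem totalDx_coord_u (k : ℕ) (hz : z ∈ B.carrier) :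
    totalDx (fun z => z.u k) z = z.u (k + 1) := by
  have hself : pd (.u k) (fun z => z.u k) z = 1 := pd_get_self (.u k) z
  have hne {i : JetCoord} (hi : .u k ≠ i) : pd i (fun z => z.u k) z = 0 := pd_get_of_ne hi z
  rw [(OrderLT.coord_u (B := B) k.lt_succ_self).totalDx_eq le_rfl hz, hne (by simp),
    Finset.sum_eq_single_of_mem k (by simp) fun j _ hj => ?_, hself, mul_one, zero_add]
  rw [hne (by simpa using hj.symm), mul_zero]

theorem isQuasilinear_of_coeff (ha : B.OrderLT 2 a) (hb : B.OrderLT 2 b) (hc : B.OrderLT 2 c)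
    (h0 : ∀ z ∈ B.carrier, a z ≠ 0) :
    B.IsQuasilinear fun z => a z * z.u 2 + b z * z.u 1 + c z := by
  have hu : B.OrderLT 3 fun z => z.u 2 := OrderLT.coord_u (by norm_num)
  have hself (z) : pd (.u 2) (fun z => z.u 2) z = 1 := pd_get_self (.u 2) z
  have hau := (ha.mono (Nat.le_succ 2)).mul hu
  have hbu := hb.mul (OrderLT.coord_u one_lt_two)
  have hpd : EqOn (pd (.u 2) fun z => a z * z.u 2 + b z * z.u 1 + c z) a B.carrier :=
    fun z hz => by
      rw [(hau.add (hbu.mono (Nat.le_succ 2))).pd_add hc _ hz, hau.pd_add hbu _ hz,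
        ha.pd_mul hu _ hz, ha.pd_u_eq_zero le_rfl hz, hbu.pd_u_eq_zero le_rfl hz,
        hc.pd_u_eq_zero le_rfl hz, hself]
      ring
  exact ⟨(hau.add (hbu.mono (Nat.le_succ 2))).add (hc.mono (Nat.le_succ 2)), ha.congr hpd,
    fun z hz => by rw [hpd hz]; exact h0 z hz⟩

/-- For a density `ρ(t, x, u)` of `u_t = a u_xx + b u_x + c` with `a`, `b`, `c` depending on
`t, x, u`, the flux is `a ρ_u u_x + τ(t, x, u)`, and `D_t ρ = D_x σ` is a polynomial identity
in `u_x`. These are its coefficients. -/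
theorem IsConservationLaw.determining_equations (ha : B.OrderLT 1 a) (hb : B.OrderLT 1 b)
    (hc : B.OrderLT 1 c) (hρ : B.OrderLT 1 ρ)
    (h : B.IsConservationLaw (fun z => a z * z.u 2 + b z * z.u 1 + c z) ρ σ) :
    ∃ τ, B.OrderLT 1 τ ∧ ∀ z ∈ B.carrier,
      pd (.u 0) (fun z => a z * pd (.u 0) ρ z) z = 0 ∧
      b z * pd (.u 0) ρ z = pd .x (fun z => a z * pd (.u 0) ρ z) z + pd (.u 0) τ z ∧
      pd .t ρ z + c z * pd (.u 0) ρ z = pd .x τ z := by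
  obtain ⟨m, hσ⟩ := isDifferentialFunction_iff.1 h.flux
  set w : JetPoint → ℝ := fun z => a z * pd (.u 0) ρ z with hw_def
  have hw : B.OrderLT 1 w := ha.mul (hρ.pd _)
  have hu : B.OrderLT 2 fun z => z.u 1 := OrderLT.coord_u one_lt_two
  have hwu := (hw.mono one_le_two).mul hu
  have hconst := (hρ.pd .t).add (hc.mul (hρ.pd (.u 0)))
  have hlin := (hb.mul (hρ.pd (.u 0))).sub (hw.pd .x)
  have hquad := (hw.pd (.u 0)).neg
  have hDτ (z) (hz : z ∈ B.carrier) : totalDx (fun z => σ z - w z * z.u 1) z =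
      (pd .t ρ z + c z * pd (.u 0) ρ z) + (b z * pd (.u 0) ρ z - pd .x w z) * z.u 1
        + (-pd (.u 0) w z) * z.u 1 ^ 2 := by
    rw [hσ.totalDx_sub hwu hz, hw.totalDx_mul hu hz, ← h.law z hz, hρ.totalDt_eq le_rfl hz,
      hw.totalDx_eq le_rfl hz, totalDx_coord_u 1 hz]
    simp only [Finset.sum_range_one, Function.iterate_zero_apply, hw_def]
    ring
  have hτ : B.OrderLT 1 fun z => σ z - w z * z.u 1 := by
    refine ((hσ.mono (le_max_left m 2)).sub (hwu.mono (le_max_right m 2))).of_totalDx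
      (OrderLT.congr ?_ hDτ)
    exact ((hconst.mono one_le_two).add ((hlin.mono one_le_two).mul hu)).add
      ((hquad.mono one_le_two).mul (hu.pow 2))
  refine ⟨_, hτ, fun z hz => ?_⟩
  obtain ⟨hconst0, hlin0, hquad0⟩ := OrderLT.quadratic_coeff_eq_zero (k := 1)
    (hconst.sub (hτ.pd .x)) (hlin.sub (hτ.pd (.u 0))) hquad (fun z hz => by
      have heq := hτ.totalDx_eq le_rfl hz
      rw [hDτ z hz, Finset.sum_range_one] at heq
      linear_combination heq) hz
  exact ⟨neg_eq_zero.1 hquad0, by linear_combination hlin0, by linear_combination hconst0⟩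

end Coefficients

section DivU

variable {P Q h : JetPoint → ℝ}

theorem OrderLT.coord_u_zero : B.OrderLT 1 fun z => z.u 0 := OrderLT.coord_u one_pos

theorem u_zero_ne_zero (hB : (0 : ℝ) ∉ B.U 0) (hz : z ∈ B.carrier) : z.u 0 ≠ 0 :=
  fun h => hB (h ▸ hz.2.2 0)

theorem OrderLT.div_u (hB : (0 : ℝ) ∉ B.U 0) (hh : B.OrderLT 0 h) :
    B.OrderLT 1 fun z => h z / z.u 0 :=
  (hh.mono zero_le_one).div OrderLT.coord_u_zero fun _ hz => u_zero_ne_zero hB hz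

theorem OrderLT.pd_u_div_u (hB : (0 : ℝ) ∉ B.U 0) (hh : B.OrderLT 0 h) (hz : z ∈ B.carrier) :
    pd (.u 0) (fun z => h z / z.u 0) z = -h z / z.u 0 ^ 2 := by
  have hself : pd (.u 0) (fun z => z.u 0) z = 1 := pd_get_self (.u 0) z
  rw [hh.pd_div OrderLT.coord_u_zero _ hz (u_zero_ne_zero hB hz), hh.pd_u_eq_zero le_rfl hz, hself]
  ring

theorem OrderLT.pd_div_u_of_ne (hB : (0 : ℝ) ∉ B.U 0) (hh : B.OrderLT 0 h) (hi : .u 0 ≠ i)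
    (hz : z ∈ B.carrier) : pd i (fun z => h z / z.u 0) z = pd i h z / z.u 0 := by
  have h0 := u_zero_ne_zero hB hz
  have hne : pd i (fun z => z.u 0) z = 0 := pd_get_of_ne (j := .u 0) hi z
  rw [hh.pd_div OrderLT.coord_u_zero _ hz h0, hne]
  field_simp
  ring

/-- The function `P u + Q / u`. With `P` and `Q` depending on `t, x` only, this is the shape of the
part of order zero of a flux belonging to a density `h / u`. -/
def laurent (P Q : JetPoint → ℝ) (z : JetPoint) : ℝ := P z * z.u 0 + Q z / z.u 0

theorem OrderLT.laurent (hB : (0 : ℝ) ∉ B.U 0) (hP : B.OrderLT 0 P) (hQ : B.OrderLT 0 Q) :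
    B.OrderLT 1 (laurent P Q) :=
  ((hP.mono zero_le_one).mul OrderLT.coord_u_zero).add (hQ.div_u hB)

theorem pd_u_laurent (hB : (0 : ℝ) ∉ B.U 0) (hP : B.OrderLT 0 P) (hQ : B.OrderLT 0 Q)
    (hz : z ∈ B.carrier) : pd (.u 0) (laurent P Q) z = P z - Q z / z.u 0 ^ 2 := by
  have hself : pd (.u 0) (fun z => z.u 0) z = 1 := pd_get_self (.u 0) z
  unfold JetBox.laurent
  rw [((hP.mono zero_le_one).mul OrderLT.coord_u_zero).pd_add (hQ.div_u hB) _ hz,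
    hP.pd_mul OrderLT.coord_u_zero _ hz, hP.pd_u_eq_zero le_rfl hz, hQ.pd_u_div_u hB hz, hself]
  ring

theorem pd_laurent_of_ne (hB : (0 : ℝ) ∉ B.U 0) (hP : B.OrderLT 0 P) (hQ : B.OrderLT 0 Q)
    (hi : .u 0 ≠ i) (hz : z ∈ B.carrier) :
    pd i (laurent P Q) z = laurent (pd i P) (pd i Q) z := by
  have hne : pd i (fun z => z.u 0) z = 0 := pd_get_of_ne (j := .u 0) hi z
  unfold JetBox.laurent
  rw [((hP.mono zero_le_one).mul OrderLT.coord_u_zero).pd_add (hQ.div_u hB) _ hz,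
    hP.pd_mul OrderLT.coord_u_zero _ hz, hQ.pd_div_u_of_ne hB hi hz, hne, mul_zero, add_zero]

theorem totalDx_laurent (hB : (0 : ℝ) ∉ B.U 0) (hP : B.OrderLT 0 P) (hQ : B.OrderLT 0 Q)
    (hz : z ∈ B.carrier) : totalDx (laurent P Q) z =
      laurent (pd .x P) (pd .x Q) z + z.u 1 * (P z - Q z / z.u 0 ^ 2) := by
  rw [(hP.laurent hB hQ).totalDx_eq le_rfl hz, Finset.sum_range_one, pd_u_laurent hB hP hQ hz,
    pd_laurent_of_ne hB hP hQ (by simp) hz]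

theorem coeff_eq_of_laurent_eq_laurent_add {P' Q' R : JetPoint → ℝ} (hB : (0 : ℝ) ∉ B.U 0)
    (hP : B.OrderLT 0 P) (hQ : B.OrderLT 0 Q) (hP' : B.OrderLT 0 P') (hQ' : B.OrderLT 0 Q')
    (hR : B.OrderLT 0 R) (h : ∀ z ∈ B.carrier, laurent P Q z = laurent P' Q' z + R z)
    (hz : z ∈ B.carrier) : P z = P' z ∧ Q z = Q' z := by
  obtain ⟨hQ0, -, hP0⟩ := (hQ.sub hQ').quadratic_coeff_eq_zero hR.neg (hP.sub hP')
    (fun z hz => by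
      have h0 := u_zero_ne_zero hB hz
      have heq := h z hz
      simp only [laurent] at heq
      field_simp at heq
      linear_combination heq) hz
  exact ⟨sub_eq_zero.1 hP0, sub_eq_zero.1 hQ0⟩

end DivU

section JetRHS

variable {β : JetPoint → ℝ}

/-- The coefficient of `u_xx` in the equation with parameter `β`. -/
def coeffTwo (β : JetPoint → ℝ) (z : JetPoint) : ℝ := pd .x β z * z.u 0 ^ 2

/-- The coefficient of `u_x` in the equation with parameter `β`. -/
def coeffOne (β : JetPoint → ℝ) (z : JetPoint) : ℝ :=
  2 * pd .x (pd .x β) z * z.u 0 ^ 2 + 4 * β z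

/-- The part free of `u_x` and `u_xx` of the equation with parameter `β`. -/
def coeffZero (β : JetPoint → ℝ) (z : JetPoint) : ℝ :=
  (pd .x (pd .x (pd .x β)) z - 4 * pd .x β z) * z.u 0 ^ 3 - 4 * pd .x β z * z.u 0

/-- The right-hand side `evolutionRHS`, for a parameter given as a function on the jet space and
with partial derivatives in place of iterated derivatives. -/
def jetRHS (β : JetPoint → ℝ) (z : JetPoint) : ℝ :=
  coeffTwo β z * z.u 2 + coeffOne β z * z.u 1 + coeffZero β z

theorem OrderLT.coeffTwo (hβ : B.OrderLT 0 β) : B.OrderLT 1 (coeffTwo β) :=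
  ((hβ.pd _).mono zero_le_one).mul (coord_u_zero.pow 2)

theorem OrderLT.coeffOne (hβ : B.OrderLT 0 β) : B.OrderLT 1 (coeffOne β) :=
  (((const 1 2).mul (((hβ.pd _).pd _).mono zero_le_one)).mul (coord_u_zero.pow 2)).add
    ((const 1 4).mul (hβ.mono zero_le_one))

theorem OrderLT.coeffZero (hβ : B.OrderLT 0 β) : B.OrderLT 1 (coeffZero β) := by
  have hlin : B.OrderLT 1 fun z => 4 * pd .x β z := (const 1 4).mul ((hβ.pd .x).mono zero_le_one)
  exact (((((hβ.pd .x).pd .x).pd .x).mono zero_le_one |>.sub hlin).mul (coord_u_zero.pow 3)).sub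
    (hlin.mul coord_u_zero)

theorem isQuasilinear_jetRHS (hB : (0 : ℝ) ∉ B.U 0) (hβ : B.OrderLT 0 β)
    (hβx : ∀ z ∈ B.carrier, pd .x β z ≠ 0) : B.IsQuasilinear (jetRHS β) :=
  isQuasilinear_of_coeff (hβ.coeffTwo.mono one_le_two) (hβ.coeffOne.mono one_le_two)
    (hβ.coeffZero.mono one_le_two) fun z hz =>
      mul_ne_zero (hβx z hz) (pow_ne_zero 2 (u_zero_ne_zero hB hz))

end JetRHS

/-! ### Densities of the form `h / u` -/

section DensityCoeff

variable {β h h' : JetPoint → ℝ}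

/-- The equations `h_xx = 4 h` and `h_t = 4 β h_x` on a function `h(t, x)`. They say that `h / u`
is the density of a conservation law of the equation with parameter `β`. -/
structure IsDensityCoeff (B : JetBox) (β h : JetPoint → ℝ) : Prop where
  orderLT : B.OrderLT 0 h
  pd_x_pd_x : ∀ z ∈ B.carrier, pd .x (pd .x h) z = 4 * h z
  pd_t : ∀ z ∈ B.carrier, pd .t h z = 4 * β z * pd .x h z

/-- The coefficient of `u` in the flux belonging to the density `h / u`. -/
def fluxCoeffU (β h : JetPoint → ℝ) (z : JetPoint) : ℝ :=
  pd .x h z * pd .x β z - h z * pd .x (pd .x β) z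

/-- The coefficient of `1 / u` in the flux belonging to the density `h / u`. -/
def fluxCoeffInvU (β h : JetPoint → ℝ) (z : JetPoint) : ℝ := 4 * (β z * h z)

/-- The flux belonging to the density `h / u`. -/
def densityCoeffFlux (β h : JetPoint → ℝ) (z : JetPoint) : ℝ :=
  -1 * (pd .x β z * h z) * z.u 1 + laurent (fluxCoeffU β h) (fluxCoeffInvU β h) z

theorem OrderLT.fluxCoeffU (hβ : B.OrderLT 0 β) (hh : B.OrderLT 0 h) :
    B.OrderLT 0 (fluxCoeffU β h) :=
  ((hh.pd _).mul (hβ.pd _)).sub (hh.mul ((hβ.pd _).pd _))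

theorem OrderLT.fluxCoeffInvU (hβ : B.OrderLT 0 β) (hh : B.OrderLT 0 h) :
    B.OrderLT 0 (fluxCoeffInvU β h) :=
  (const 0 4).mul (hβ.mul hh)

theorem pd_x_fluxCoeffU (hβ : B.OrderLT 0 β) (hh : B.OrderLT 0 h) (hz : z ∈ B.carrier) :
    pd .x (fluxCoeffU β h) z =
      pd .x (pd .x h) z * pd .x β z - h z * pd .x (pd .x (pd .x β)) z := by
  have hβx := hβ.pd .x
  have hhx := hh.pd .x
  unfold JetBox.fluxCoeffU
  rw [(hhx.mul hβx).pd_sub (hh.mul (hβx.pd .x)) _ hz, hhx.pd_mul hβx _ hz,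
    hh.pd_mul (hβx.pd .x) _ hz]
  ring

theorem pd_x_fluxCoeffInvU (hβ : B.OrderLT 0 β) (hh : B.OrderLT 0 h) (hz : z ∈ B.carrier) :
    pd .x (fluxCoeffInvU β h) z = 4 * (pd .x β z * h z + β z * pd .x h z) := by
  unfold JetBox.fluxCoeffInvU
  rw [pd_const_mul, hβ.pd_mul hh _ hz]

theorem coeffTwo_mul_pd_u_div_u (hB : (0 : ℝ) ∉ B.U 0) (hh : B.OrderLT 0 h)
    (hz : z ∈ B.carrier) :
    coeffTwo β z * pd (.u 0) (fun z => h z / z.u 0) z = -1 * (pd .x β z * h z) := by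
  have h0 := u_zero_ne_zero hB hz
  rw [coeffTwo, hh.pd_u_div_u hB hz]
  field_simp

theorem orderLT_sub_laurent_of_determining_equation {τ : JetPoint → ℝ}
    (hB : (0 : ℝ) ∉ B.U 0) (hβ : B.OrderLT 0 β) (hh : B.OrderLT 0 h) (hτ : B.OrderLT 1 τ)
    (hdet : ∀ z ∈ B.carrier, coeffOne β z * pd (.u 0) (fun z => h z / z.u 0) z =
      pd .x (fun z => coeffTwo β z * pd (.u 0) (fun z => h z / z.u 0) z) z + pd (.u 0) τ z) :
    B.OrderLT 0 fun z => τ z - laurent (fluxCoeffU β h) (fluxCoeffInvU β h) z := by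
  have hP := hβ.fluxCoeffU hh
  have hQ := hβ.fluxCoeffInvU hh
  have hPQ := hP.laurent hB hQ
  refine (hτ.sub hPQ).of_pd_u_eq_zero fun z hz => ?_
  have h0 := u_zero_ne_zero hB hz
  have hτu := hdet z hz
  rw [pd_congr (fun z hz => coeffTwo_mul_pd_u_div_u hB hh hz) _ hz, pd_const_mul,
    (hβ.pd .x).pd_mul hh _ hz, hh.pd_u_div_u hB hz, coeffOne] at hτu
  rw [hτ.pd_sub hPQ _ hz, pd_u_laurent hB hP hQ hz, fluxCoeffU, fluxCoeffInvU]
  field_simp at hτu ⊢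
  linear_combination -hτu

theorem IsConservationLaw.isDensityCoeff (hB : (0 : ℝ) ∉ B.U 0) (hβ : B.OrderLT 0 β)
    (hβx : ∀ z ∈ B.carrier, pd .x β z ≠ 0) (hh : B.OrderLT 0 h)
    (hlaw : B.IsConservationLaw (jetRHS β) (fun z => h z / z.u 0) σ) : B.IsDensityCoeff β h := by
  obtain ⟨τ, hτ, hdet⟩ := IsConservationLaw.determining_equations hβ.coeffTwo hβ.coeffOne
    hβ.coeffZero (hh.div_u hB) hlaw
  have hP := hβ.fluxCoeffU hh
  have hQ := hβ.fluxCoeffInvU hh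
  have hR := orderLT_sub_laurent_of_determining_equation hB hβ hh hτ
    fun z hz => (hdet z hz).2.1
  have hβx' := (OrderLT.const 0 4).mul (hβ.pd .x)
  have hcoeff {z} (hz : z ∈ B.carrier) := coeff_eq_of_laurent_eq_laurent_add hB
    (P := fun z => -(pd .x (pd .x (pd .x β)) z - 4 * pd .x β z) * h z)
    (Q := fun z => pd .t h z + 4 * pd .x β z * h z)
    ((((hβ.pd .x).pd .x).pd .x |>.sub hβx').neg.mul hh) ((hh.pd .t).add (hβx'.mul hh))
    (hP.pd .x) (hQ.pd .x) (hR.pd .x) (fun z hz => by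
      have h0 := u_zero_ne_zero hB hz
      rw [hτ.pd_sub (hP.laurent hB hQ) _ hz, pd_laurent_of_ne hB hP hQ (by simp) hz,
        ← (hdet z hz).2.2, hh.pd_u_div_u hB hz, hh.pd_div_u_of_ne hB (by simp) hz]
      simp only [laurent, coeffZero]
      field_simp
      ring) hz
  refine ⟨hh, fun z hz => ?_, fun z hz => ?_⟩
  · have hP_eq := (hcoeff hz).1
    rw [pd_x_fluxCoeffU hβ hh hz] at hP_eq
    exact mul_right_cancel₀ (hβx z hz) (by linear_combination -hP_eq)
  · have hQ_eq := (hcoeff hz).2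
    rw [pd_x_fluxCoeffInvU hβ hh hz] at hQ_eq
    linear_combination hQ_eq

theorem IsConservationLaw.exists_orderLT_sub_div_u (hB : (0 : ℝ) ∉ B.U 0) (hβ : B.OrderLT 0 β)
    (hβx : ∀ z ∈ B.carrier, pd .x β z ≠ 0) (hlaw : B.IsConservationLaw (jetRHS β) ρ σ)
    (hρ : B.OrderLT 1 ρ) :
    ∃ h, B.OrderLT 0 h ∧ B.OrderLT 0 fun z => ρ z - h z / z.u 0 := by
  obtain ⟨τ, -, hdet⟩ := IsConservationLaw.determining_equations hβ.coeffTwo hβ.coeffOne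
    hβ.coeffZero hρ hlaw
  have hw : B.OrderLT 0 fun z => coeffTwo β z * pd (.u 0) ρ z :=
    (hβ.coeffTwo.mul (hρ.pd _)).of_pd_u_eq_zero fun z hz => (hdet z hz).1
  have hh := hw.neg.div (hβ.pd .x) hβx
  refine ⟨_, hh, (hρ.sub (hh.div_u hB)).of_pd_u_eq_zero fun z hz => ?_⟩
  have h0 := u_zero_ne_zero hB hz
  have hβx0 := hβx z hz
  rw [hρ.pd_sub (hh.div_u hB) _ hz, hh.pd_u_div_u hB hz, coeffTwo]
  field_simp
  ring

theorem IsConservationLaw.exists_isDensityCoeff (hB : (0 : ℝ) ∉ B.U 0) (hβ : B.OrderLT 0 β)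
    (hβx : ∀ z ∈ B.carrier, pd .x β z ≠ 0) (hlaw : B.IsConservationLaw (jetRHS β) ρ σ) :
    ∃ h n f, B.IsDensityCoeff β h ∧ B.OrderLT n f ∧
      ∀ z ∈ B.carrier, ρ z - totalDx f z = h z / z.u 0 := by
  have hF := isQuasilinear_jetRHS hB hβ hβx
  obtain ⟨n, f, hf, hρ⟩ := hlaw.exists_orderLT_one_sub_totalDx hF
  have hlaw_f := hlaw.sub_totalDx hF.orderLT hf
  obtain ⟨h, hh, hhρ⟩ := hlaw_f.exists_orderLT_sub_div_u hB hβ hβx hρ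
  obtain ⟨G, hG, hGρ⟩ := hhρ.exists_primitive (i := .x) (by simp)
  have hfG : B.OrderLT n fun z => f z + G z := hf.add (hG.mono (Nat.zero_le n))
  have hρ_eq (z) (hz : z ∈ B.carrier) :
      ρ z - totalDx (fun z => f z + G z) z = h z / z.u 0 := by
    rw [hf.totalDx_add hG hz, hG.totalDx_eq_pd hz, hGρ z hz]
    ring
  have hlaw_fG := hlaw.sub_totalDx hF.orderLT hfG
  exact ⟨h, n, _, (hlaw_fG.congr (fun z hz => (hρ_eq z hz).symm) fun _ _ => rfl).isDensityCoeff
    hB hβ hβx hh, hfG, hρ_eq⟩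

namespace IsDensityCoeff

theorem isConservationLaw (hB : (0 : ℝ) ∉ B.U 0) (hβ : B.OrderLT 0 β)
    (h : B.IsDensityCoeff β h') :
    B.IsConservationLaw (jetRHS β) (fun z => h' z / z.u 0) (densityCoeffFlux β h') := by
  have hh := h.orderLT
  have hβh := (OrderLT.const 0 (-1)).mul ((hβ.pd .x).mul hh)
  have hu : B.OrderLT 2 fun z => z.u 1 := OrderLT.coord_u one_lt_two
  have hβhu := (hβh.mono zero_le_two).mul hu
  have hP := hβ.fluxCoeffU hh
  have hQ := hβ.fluxCoeffInvU hh
  have hPQ := hP.laurent hB hQ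
  refine ⟨(hh.div_u hB).isDifferentialFunction,
    (hβhu.add (hPQ.mono one_le_two)).isDifferentialFunction, fun z hz => ?_⟩
  have h0 := u_zero_ne_zero hB hz
  unfold densityCoeffFlux
  rw [(hh.div_u hB).totalDt_eq le_rfl hz, Finset.sum_range_one, Function.iterate_zero_apply,
    hh.pd_u_div_u hB hz, hh.pd_div_u_of_ne hB (by simp) hz, hβhu.totalDx_add hPQ hz,
    hβh.totalDx_mul hu hz, totalDx_coord_u 1 hz, hβh.totalDx_eq_pd hz, pd_const_mul,
    (hβ.pd .x).pd_mul hh _ hz, totalDx_laurent hB hP hQ hz, laurent, pd_x_fluxCoeffU hβ hh hz,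
    pd_x_fluxCoeffInvU hβ hh hz, fluxCoeffU, fluxCoeffInvU, h.pd_x_pd_x z hz, h.pd_t z hz]
  simp only [jetRHS, coeffTwo, coeffOne, coeffZero]
  field_simp
  ring

theorem sub (h : B.IsDensityCoeff β f) (h' : B.IsDensityCoeff β f') :
    B.IsDensityCoeff β fun z => f z - f' z := by
  have hpd {z} (hz : z ∈ B.carrier) (i) := h.orderLT.pd_sub h'.orderLT i hz
  refine ⟨h.orderLT.sub h'.orderLT, fun z hz => ?_, fun z hz => ?_⟩
  · rw [pd_congr (fun z hz => hpd hz .x) _ hz, (h.orderLT.pd _).pd_sub (h'.orderLT.pd _) _ hz,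
      h.pd_x_pd_x z hz, h'.pd_x_pd_x z hz]
    ring
  · rw [hpd hz, hpd hz, h.pd_t z hz, h'.pd_t z hz]
    ring

theorem const_mul (h : B.IsDensityCoeff β f) (a : ℝ) : B.IsDensityCoeff β fun z => a * f z := by
  refine ⟨(OrderLT.const 0 a).mul h.orderLT, fun z hz => ?_, fun z hz => ?_⟩
  · rw [pd_congr (fun z _ => pd_const_mul .x a f z) _ hz, pd_const_mul, h.pd_x_pd_x z hz]
    ring
  · rw [pd_const_mul, pd_const_mul, h.pd_t z hz]
    ring

/-- Equality of the mixed derivatives `h_xxt` and `h_txx`. -/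
theorem compatibility (hβ : B.OrderLT 0 β) (h : B.IsDensityCoeff β f) (hz : z ∈ B.carrier) :
    8 * pd .x β z * f z = -pd .x (pd .x β) z * pd .x f z := by
  have hf := h.orderLT
  have hfx := hf.pd .x
  have hβ4 := (OrderLT.const 0 4).mul hβ
  have hβ4x : EqOn (pd .x fun z => 4 * β z) (fun z => 4 * pd .x β z) B.carrier :=
    fun z _ => pd_const_mul _ _ _ z
  have hft : EqOn (pd .x (pd .t f)) (fun z => 4 * pd .x β z * pd .x f z + 4 * β z * (4 * f z))
      B.carrier := fun z hz => by
    rw [pd_congr h.pd_t _ hz, hβ4.pd_mul hfx _ hz, hβ4x hz, h.pd_x_pd_x z hz]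
  have hftxx : pd .x (pd .x (pd .t f)) z = 4 * pd .t f z := by
    rw [pd_congr (fun z hz => hf.pd_comm .x .t hz) _ hz, hfx.pd_comm .x .t hz,
      pd_congr h.pd_x_pd_x _ hz, pd_const_mul]
  have hβx4 := (OrderLT.const 0 4).mul (hβ.pd .x)
  have hf4 := (OrderLT.const 0 4).mul hf
  rw [pd_congr hft _ hz, (hβx4.mul hfx).pd_add (hβ4.mul hf4) _ hz, hβx4.pd_mul hfx _ hz,
    hβ4.pd_mul hf4 _ hz, pd_const_mul, pd_const_mul, pd_const_mul,
    h.pd_x_pd_x z hz, h.pd_t z hz] at hftxx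
  linear_combination hftxx / 4

end IsDensityCoeff

theorem eq_zero_of_isTrivialLaw_div_u (hB : (0 : ℝ) ∉ B.U 0) (hh : B.OrderLT 0 h)
    (htriv : B.IsTrivialLaw F (fun z => h z / z.u 0) σ) (hz : z ∈ B.carrier) : h z = 0 := by
  obtain ⟨f, hf, hfeq⟩ := htriv
  obtain ⟨n, hf⟩ := isDifferentialFunction_iff.1 hf
  have hDf (z) (hz : z ∈ B.carrier) : totalDx f z = h z / z.u 0 := (hfeq z hz).1.symm
  have hf : B.OrderLT 0 f := hf.of_totalDx ((hh.div_u hB).congr hDf)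
  have hfx : EqOn (fun z => h z / z.u 0) (pd .x f) B.carrier :=
    fun z hz => (hDf z hz).symm.trans (hf.totalDx_eq_pd hz)
  have hpd := hh.pd_u_div_u hB hz
  rw [pd_congr hfx _ hz, (hf.pd .x).pd_u_eq_zero le_rfl hz] at hpd
  have h0 := u_zero_ne_zero hB hz
  field_simp at hpd
  linarith

end DensityCoeff

section LinearODE

variable {y a b : JetPoint → ℝ} {z' : JetPoint}

namespace OrderLT

protected theorem exp (h : B.OrderLT n f) : B.OrderLT n fun z => Real.exp (f z) := by
  obtain ⟨g, hg, hfg⟩ := h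
  exact ⟨fun y => Real.exp (g y), hg.exp, fun z hz => by simp only [hfg z hz]⟩

theorem pd_exp (h : B.OrderLT n f) (i : JetCoord) (hz : z ∈ B.carrier) :
    pd i (fun z => Real.exp (f z)) z = Real.exp (f z) * pd i f z := by
  have hexp := (h.hasDerivAt i hz).exp
  rw [set_get] at hexp
  exact hexp.deriv

theorem eq_of_t_eq_of_x_eq (h : B.OrderLT 0 f) (hz : z ∈ B.carrier) (hz' : z' ∈ B.carrier)
    (ht : z.t = z'.t) (hx : z.x = z'.x) : f z = f z' := by
  obtain ⟨g, -, hfg⟩ := h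
  rw [hfg z hz, hfg z' hz']
  exact congrArg g (Prod.ext ht (Prod.ext hx (Subsingleton.elim _ _)))

theorem contDiffOn_mk (h : B.OrderLT 0 f) (hz : z ∈ B.carrier) :
    ContDiffOn ℝ ∞ (fun y : ℝ × ℝ => f ⟨y.1, y.2, z.u⟩) (B.I ×ˢ B.J) := by
  obtain ⟨g, hg, hfg⟩ := h
  have hg_mk : ContDiffOn ℝ ∞ (fun y : ℝ × ℝ => g (y.1, y.2, fun i : Fin 0 => z.u i))
      (B.I ×ˢ B.J) :=
    hg.comp (ContDiff.contDiffOn (by fun_prop)) fun y hy => ⟨hy.1, hy.2, fun i => i.elim0⟩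
  exact hg_mk.congr fun y hy => hfg _ ⟨hy.1, hy.2, hz.2.2⟩

theorem apply_set_eq_zero_of_pd_eq_mul (hy : B.OrderLT n y) (ha : B.OrderLT n a)
    (hi : ∀ k, i = .u k → k < n) (hya : ∀ z ∈ B.carrier, pd i y z = a z * y z)
    (hz : z ∈ B.carrier) (h0 : y z = 0) {s : ℝ} (hs : s ∈ B.range i) : y (z.set i s) = 0 := by
  obtain ⟨A, hA, hAa⟩ := ha.exists_primitive hi
  have hyA := hy.mul hA.neg.exp
  have hpd (z) (hz : z ∈ B.carrier) : pd i (fun z => y z * Real.exp (-A z)) z = 0 := by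
    have hneg : pd i (fun z => -A z) z = -a z := by
      simpa only [neg_one_mul, hAa z hz] using pd_const_mul i (-1) A z
    rw [hy.pd_mul hA.neg.exp _ hz, hA.neg.pd_exp _ hz, hneg, hya z hz]
    ring
  have hconst := hyA.apply_set_eq_of_pd_eq_zero hpd hz hs
  rw [h0, zero_mul] at hconst
  exact (mul_eq_zero.1 hconst).resolve_right (Real.exp_ne_zero _)

theorem eq_zero_of_pd_t_eq_mul_of_pd_x_eq_mul (hy : B.OrderLT 0 y) (ha : B.OrderLT 0 a)
    (hb : B.OrderLT 0 b) (hyt : ∀ z ∈ B.carrier, pd .t y z = a z * y z)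
    (hyx : ∀ z ∈ B.carrier, pd .x y z = b z * y z) (hz : z ∈ B.carrier) (h0 : y z = 0)
    (hz' : z' ∈ B.carrier) : y z' = 0 := by
  have hzt : z.set .t z'.t ∈ B.carrier := set_mem hz hz'.1
  have hzt0 := hy.apply_set_eq_zero_of_pd_eq_mul ha (by simp) hyt hz h0 (s := z'.t) hz'.1
  rw [hy.eq_of_t_eq_of_x_eq (z' := (z.set .t z'.t).set .x z'.x) hz' (set_mem hzt hz'.2.1) rfl rfl]
  exact hy.apply_set_eq_zero_of_pd_eq_mul hb (by simp) hyx hzt hzt0 hz'.2.1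

theorem exists_eq_mul_exp_of_pd_x_eq_const_mul (hy : B.OrderLT 0 y) (k : ℝ)
    (hyx : ∀ z ∈ B.carrier, pd .x y z = k * y z) :
    ∃ r : ℝ → ℝ, ContDiffOn ℝ ∞ r B.I ∧ ∀ z ∈ B.carrier, y z = r z.t * Real.exp (k * z.x) := by
  obtain ⟨z₀, hz₀⟩ := B.carrier_nonempty
  have hkx : B.OrderLT 0 fun z => -k * z.x :=
    of_contDiffOn (a := fun _ x => -k * x) (ContDiff.contDiffOn (by fun_prop))
  have hkx_pd (z) : pd .x (fun z => -k * z.x) z = -k := by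
    have hself : pd .x (fun z => z.x) z = 1 := pd_get_self .x z
    rw [pd_const_mul, hself, mul_one]
  have hR := hy.mul hkx.exp
  refine ⟨fun t => y ⟨t, z₀.x, z₀.u⟩ * Real.exp (-k * z₀.x),
    (hR.contDiffOn_mk hz₀).comp (f := fun t => (t, z₀.x)) (ContDiff.contDiffOn (by fun_prop))
      fun t ht => ⟨ht, hz₀.2.1⟩, fun z hz => ?_⟩
  have hconst : y (z.set .x z₀.x) * Real.exp (-k * z₀.x) = y z * Real.exp (-k * z.x) :=
    hR.apply_set_eq_of_pd_eq_zero (i := .x) (fun z hz => by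
      rw [hy.pd_mul hkx.exp _ hz, hkx.pd_exp _ hz, hkx_pd, hyx z hz]
      ring) hz hz₀.2.1
  have hzx : y (z.set .x z₀.x) = y ⟨z.t, z₀.x, z₀.u⟩ :=
    hy.eq_of_t_eq_of_x_eq (set_mem hz hz₀.2.1) ⟨hz.1, hz₀.2⟩ rfl rfl
  beta_reduce
  rw [← hzx, hconst, mul_assoc, ← Real.exp_add, neg_mul, neg_add_cancel, Real.exp_zero, mul_one]

end OrderLT

end LinearODE

section DensityCoeffUniqueness

variable {β : JetPoint → ℝ} {z₀ : JetPoint}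

namespace IsDensityCoeff

theorem eq_zero_of_pd_x_eq_zero (hβ : B.OrderLT 0 β) (hβx : ∀ z ∈ B.carrier, pd .x β z ≠ 0)
    (h : B.IsDensityCoeff β f) (hz₀ : z₀ ∈ B.carrier) (h0 : pd .x f z₀ = 0)
    (hz : z ∈ B.carrier) : f z = 0 := by
  have hf := h.orderLT
  have hfx := hf.pd .x
  have hβ4 := (OrderLT.const 0 4).mul hβ
  have hβ8x := (OrderLT.const 0 8).mul (hβ.pd .x)
  have ha : B.OrderLT 0 fun z => -(pd .x (pd .x β) z / (8 * pd .x β z)) :=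
    (((hβ.pd .x).pd .x).div hβ8x fun z hz => mul_ne_zero (by norm_num) (hβx z hz)).neg
  have hf_eq (z) (hz : z ∈ B.carrier) :
      f z = -(pd .x (pd .x β) z / (8 * pd .x β z)) * pd .x f z := by
    have hβx0 := hβx z hz
    have hcompat := h.compatibility hβ hz
    field_simp
    linear_combination hcompat
  have hfxt (z) (hz : z ∈ B.carrier) : pd .t (pd .x f) z =
      (4 * pd .x β z + 16 * (β z * -(pd .x (pd .x β) z / (8 * pd .x β z)))) * pd .x f z := by
    rw [hf.pd_comm .t .x hz, pd_congr h.pd_t _ hz, hβ4.pd_mul hfx _ hz, pd_const_mul,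
      h.pd_x_pd_x z hz, hf_eq z hz]
    ring
  have hfxx (z) (hz : z ∈ B.carrier) : pd .x (pd .x f) z =
      4 * -(pd .x (pd .x β) z / (8 * pd .x β z)) * pd .x f z := by
    rw [h.pd_x_pd_x z hz, hf_eq z hz, mul_assoc]
  rw [hf_eq z hz, hfx.eq_zero_of_pd_t_eq_mul_of_pd_x_eq_mul
    (((OrderLT.const 0 4).mul (hβ.pd .x)).add ((OrderLT.const 0 16).mul (hβ.mul ha)))
    ((OrderLT.const 0 4).mul ha) hfxt hfxx hz₀ h0 hz, mul_zero]

theorem exists_eq_const_mul (hβ : B.OrderLT 0 β) (hβx : ∀ z ∈ B.carrier, pd .x β z ≠ 0)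
    (h : B.IsDensityCoeff β f) (h' : B.IsDensityCoeff β f') (hz₀ : z₀ ∈ B.carrier)
    (h0 : pd .x f' z₀ ≠ 0) : ∃ a : ℝ, ∀ z ∈ B.carrier, f z = a * f' z := by
  set a := pd .x f z₀ / pd .x f' z₀
  have hsub := h.sub (h'.const_mul a)
  have hpd : pd .x (fun z => f z - a * f' z) z₀ = 0 := by
    rw [h.orderLT.pd_sub (h'.const_mul a).orderLT _ hz₀, pd_const_mul, div_mul_cancel₀ _ h0,
      sub_self]
  exact ⟨a, fun z hz => sub_eq_zero.1 (hsub.eq_zero_of_pd_x_eq_zero hβ hβx hz₀ hpd hz)⟩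

end IsDensityCoeff

theorem IsConservationLaw.exists_isTrivialLaw_sub (hB : (0 : ℝ) ∉ B.U 0) (hβ : B.OrderLT 0 β)
    (hβx : ∀ z ∈ B.carrier, pd .x β z ≠ 0) (hf : B.IsDensityCoeff β f) (hz₀ : z₀ ∈ B.carrier)
    (h0 : pd .x f z₀ ≠ 0) (hlaw_f : B.IsConservationLaw (jetRHS β) (fun z => f z / z.u 0) σ')
    (hlaw : B.IsConservationLaw (jetRHS β) ρ σ) :
    ∃ a : ℝ, B.IsTrivialLaw (jetRHS β) (fun z => ρ z - a * (f z / z.u 0))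
      (fun z => σ z - a * σ' z) := by
  obtain ⟨h, n, g, hh, hg, hρ⟩ := hlaw.exists_isDensityCoeff hB hβ hβx
  obtain ⟨a, ha⟩ := hh.exists_eq_const_mul hβ hβx hf hz₀ h0
  refine ⟨a, (hlaw.sub (hlaw_f.const_mul a)).isTrivialLaw
    (isQuasilinear_jetRHS hB hβ hβx).orderLT hg fun z hz => ?_⟩
  linear_combination hρ z hz + ha z hz / z.u 0

theorem IsConservationLaw.exists_isDensityCoeff_ne_zero (hB : (0 : ℝ) ∉ B.U 0)
    (hβ : B.OrderLT 0 β) (hβx : ∀ z ∈ B.carrier, pd .x β z ≠ 0)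
    (hlaw : B.IsConservationLaw (jetRHS β) ρ σ) (hnontriv : ¬ B.IsTrivialLaw (jetRHS β) ρ σ) :
    ∃ h, B.IsDensityCoeff β h ∧ ∃ z ∈ B.carrier, h z ≠ 0 := by
  obtain ⟨h, n, f, hh, hf, hρ⟩ := hlaw.exists_isDensityCoeff hB hβ hβx
  refine ⟨h, hh, by_contra fun h0 => hnontriv ?_⟩
  push Not at h0
  refine hlaw.isTrivialLaw (isQuasilinear_jetRHS hB hβ hβx).orderLT hf fun z hz => ?_
  have hρz := hρ z hz
  rwa [h0 z hz, zero_div, sub_eq_zero] at hρz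

end DensityCoeffUniqueness

/-! ### The special parameter -/

section SpecialParameter

variable {p q : ℝ → ℝ} {t : ℝ}

/-- The function `p e^{2x} + q e^{-2x}`, the general solution of `h_xx = 4 h`. -/
def expSum (p q : ℝ → ℝ) (z : JetPoint) : ℝ :=
  p z.t * Real.exp (2 * z.x) + q z.t * Real.exp (-2 * z.x)

/-- The function `p e^{2x} - q e^{-2x}`, half the `x`-derivative of `expSum p q`. -/
def expDiff (p q : ℝ → ℝ) (z : JetPoint) : ℝ :=
  p z.t * Real.exp (2 * z.x) - q z.t * Real.exp (-2 * z.x)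

/-- The parameter given by the formula of `IsSpecialParameter`, as a function on the jet space. -/
def specialParameter (p q : ℝ → ℝ) (z : JetPoint) : ℝ :=
  1 / 8 * (expSum (deriv p) (deriv q) z / expDiff p q z)

theorem expDiff_eq_expSum_neg (p q : ℝ → ℝ) : expDiff p q = expSum p (-q) := by
  funext z
  simp [expDiff, expSum, sub_eq_add_neg]

theorem pd_x_expSum (p q : ℝ → ℝ) (z : JetPoint) : pd .x (expSum p q) z = 2 * expDiff p q z := by
  have hexp (k : ℝ) : HasDerivAt (fun s => Real.exp (k * s)) (Real.exp (k * z.x) * k) z.x :=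
    ((hasDerivAt_id z.x).const_mul k).exp.congr_deriv (by rw [id, mul_one])
  have hsum := ((hexp 2).const_mul (p z.t)).add ((hexp (-2)).const_mul (q z.t))
  refine hsum.deriv.trans ?_
  rw [expDiff]
  ring

theorem pd_x_expDiff (p q : ℝ → ℝ) (z : JetPoint) : pd .x (expDiff p q) z = 2 * expSum p q z := by
  rw [expDiff_eq_expSum_neg, pd_x_expSum, expDiff_eq_expSum_neg, neg_neg]

theorem pd_x_pd_x_expSum (p q : ℝ → ℝ) (z : JetPoint) :
    pd .x (pd .x (expSum p q)) z = 4 * expSum p q z := by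
  rw [funext (pd_x_expSum p q), pd_const_mul, pd_x_expDiff]
  ring

theorem differentiableAt_of_contDiffOn_I (hp : ContDiffOn ℝ ∞ p B.I) (ht : t ∈ B.I) :
    DifferentiableAt ℝ p t :=
  (hp.differentiableOn (by simp)).differentiableAt (B.isOpen_I.mem_nhds ht)

theorem contDiffOn_deriv_I (hp : ContDiffOn ℝ ∞ p B.I) : ContDiffOn ℝ ∞ (deriv p) B.I :=
  ((contDiffOn_infty_iff_deriv_of_isOpen B.isOpen_I).1 hp).2

theorem deriv_mul_of_contDiffOn_I (hp : ContDiffOn ℝ ∞ p B.I) (hq : ContDiffOn ℝ ∞ q B.I)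
    (ht : t ∈ B.I) : deriv (fun s => p s * q s) t = deriv p t * q t + p t * deriv q t :=
  deriv_fun_mul (differentiableAt_of_contDiffOn_I hp ht) (differentiableAt_of_contDiffOn_I hq ht)

theorem pd_t_expSum (hp : ContDiffOn ℝ ∞ p B.I) (hq : ContDiffOn ℝ ∞ q B.I)
    (hz : z ∈ B.carrier) : pd .t (expSum p q) z = expSum (deriv p) (deriv q) z :=
  (((differentiableAt_of_contDiffOn_I hp hz.1).hasDerivAt.mul_const (Real.exp (2 * z.x))).add
    ((differentiableAt_of_contDiffOn_I hq hz.1).hasDerivAt.mul_const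
      (Real.exp (-2 * z.x)))).deriv

theorem orderLT_of_contDiffOn_I (hp : ContDiffOn ℝ ∞ p B.I) : B.OrderLT 0 fun z => p z.t :=
  OrderLT.of_contDiffOn (a := fun t _ => p t) (hp.comp contDiffOn_fst fun _ hy => hy.1)

theorem orderLT_expSum (hp : ContDiffOn ℝ ∞ p B.I) (hq : ContDiffOn ℝ ∞ q B.I) :
    B.OrderLT 0 (expSum p q) := by
  have hexp (k : ℝ) : B.OrderLT 0 fun z => Real.exp (k * z.x) :=
    OrderLT.of_contDiffOn (a := fun _ x => Real.exp (k * x)) (ContDiff.contDiffOn (by fun_prop))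
  exact ((orderLT_of_contDiffOn_I hp).mul (hexp 2)).add
    ((orderLT_of_contDiffOn_I hq).mul (hexp (-2)))

theorem orderLT_expDiff (hp : ContDiffOn ℝ ∞ p B.I) (hq : ContDiffOn ℝ ∞ q B.I) :
    B.OrderLT 0 (expDiff p q) := by
  rw [expDiff_eq_expSum_neg]
  exact orderLT_expSum hp hq.neg

theorem exp_two_mul_mul_exp_neg_two_mul (x : ℝ) : Real.exp (2 * x) * Real.exp (-2 * x) = 1 := by
  rw [← Real.exp_add, neg_mul, add_neg_cancel, Real.exp_zero]

theorem expDiff_sq_eq (p q : ℝ → ℝ) (z : JetPoint) :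
    expDiff p q z ^ 2 = expSum p q z ^ 2 - 4 * (p z.t * q z.t) := by
  rw [expDiff, expSum]
  linear_combination (-4 * p z.t * q z.t) * exp_two_mul_mul_exp_neg_two_mul z.x

theorem expSum_deriv_mul_sub_expDiff_deriv_mul (hp : ContDiffOn ℝ ∞ p B.I)
    (hq : ContDiffOn ℝ ∞ q B.I) (hz : z ∈ B.carrier) :
    expSum (deriv p) (deriv q) z * expSum p q z - expDiff (deriv p) (deriv q) z * expDiff p q z =
      2 * deriv (fun s => p s * q s) z.t := by
  rw [deriv_mul_of_contDiffOn_I hp hq hz.1]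
  simp only [expDiff, expSum]
  linear_combination (2 * (deriv p z.t * q z.t + p z.t * deriv q z.t)) *
    exp_two_mul_mul_exp_neg_two_mul z.x

theorem orderLT_specialParameter (hp : ContDiffOn ℝ ∞ p B.I) (hq : ContDiffOn ℝ ∞ q B.I)
    (hD : ∀ z ∈ B.carrier, expDiff p q z ≠ 0) : B.OrderLT 0 (specialParameter p q) :=
  (OrderLT.const 0 (1 / 8)).mul
    ((orderLT_expSum (contDiffOn_deriv_I hp) (contDiffOn_deriv_I hq)).div (orderLT_expDiff hp hq)
      hD)

theorem pd_x_specialParameter (hp : ContDiffOn ℝ ∞ p B.I) (hq : ContDiffOn ℝ ∞ q B.I)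
    (hz : z ∈ B.carrier) (hD : expDiff p q z ≠ 0) :
    pd .x (specialParameter p q) z =
      -1 / 2 * (deriv (fun s => p s * q s) z.t / expDiff p q z ^ 2) := by
  have hS := orderLT_expSum (contDiffOn_deriv_I hp) (contDiffOn_deriv_I hq)
  have hwronskian := expSum_deriv_mul_sub_expDiff_deriv_mul hp hq hz
  unfold specialParameter
  rw [pd_const_mul, hS.pd_div (orderLT_expDiff hp hq) _ hz hD, pd_x_expSum, pd_x_expDiff]
  field_simp
  linear_combination -4 * hwronskian

theorem pd_x_pd_x_specialParameter (hp : ContDiffOn ℝ ∞ p B.I) (hq : ContDiffOn ℝ ∞ q B.I)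
    (hD : ∀ z ∈ B.carrier, expDiff p q z ≠ 0) (hz : z ∈ B.carrier) :
    pd .x (pd .x (specialParameter p q)) z =
      2 * (deriv (fun s => p s * q s) z.t * expSum p q z) / expDiff p q z ^ 3 := by
  have hw : B.OrderLT 0 fun z => deriv (fun s => p s * q s) z.t :=
    orderLT_of_contDiffOn_I (contDiffOn_deriv_I (hp.mul hq))
  have hw_x : pd .x (fun z => deriv (fun s => p s * q s) z.t) z = 0 :=
    deriv_const z.x (deriv (fun s => p s * q s) z.t)
  have hDs := orderLT_expDiff hp hq
  have hβx : EqOn (pd .x (specialParameter p q)) (fun z => -1 / 2 *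
      (deriv (fun s => p s * q s) z.t / (expDiff p q z * expDiff p q z))) B.carrier :=
    fun z hz => by rw [pd_x_specialParameter hp hq hz (hD z hz), sq]
  have h0 := hD z hz
  rw [pd_congr hβx _ hz, pd_const_mul, hw.pd_div (hDs.mul hDs) _ hz (mul_ne_zero h0 h0),
    hDs.pd_mul hDs _ hz, pd_x_expDiff, hw_x]
  field_simp
  ring

theorem specialFlux_eq (p q : ℝ → ℝ) (z : JetPoint) :
    specialFlux p q z =
      1 / 2 * (deriv (fun s => p s * q s) z.t * expSum p q z / expDiff p q z ^ 2) * z.u 1 +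
        1 / 2 * (expSum (deriv p) (deriv q) z * expSum p q z / expDiff p q z) * (1 / z.u 0) -
        deriv (fun s => p s * q s) z.t * (expDiff p q z ^ 2 + 2 * expSum p q z ^ 2) /
          expDiff p q z ^ 3 * z.u 0 := by
  have hexp (k : ℝ) : Real.exp (2 * k * z.x) = Real.exp (k * z.x) ^ 2 := by
    rw [← Real.exp_nat_mul, Nat.cast_ofNat, mul_assoc]
  have hexp_two : Real.exp (4 * z.x) = Real.exp (2 * z.x) ^ 2 := by rw [← hexp]; norm_num
  have hexp_neg : Real.exp (-4 * z.x) = Real.exp (-2 * z.x) ^ 2 := by rw [← hexp]; norm_num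
  have hcoeff : 3 * p z.t ^ 2 * Real.exp (4 * z.x) + 2 * p z.t * q z.t +
      3 * q z.t ^ 2 * Real.exp (-4 * z.x) = expDiff p q z ^ 2 + 2 * expSum p q z ^ 2 := by
    have hsq := expDiff_sq_eq p q z
    rw [hexp_two, hexp_neg]
    simp only [expDiff, expSum] at hsq ⊢
    linear_combination hsq / 2
  rw [specialFlux, hcoeff]
  rfl

theorem specialFlux_eq_densityCoeffFlux (hB : (0 : ℝ) ∉ B.U 0) (hp : ContDiffOn ℝ ∞ p B.I)
    (hq : ContDiffOn ℝ ∞ q B.I) (hD : ∀ z ∈ B.carrier, expDiff p q z ≠ 0) (hz : z ∈ B.carrier) :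
    specialFlux p q z = densityCoeffFlux (specialParameter p q) (expSum p q) z := by
  have h0 := hD z hz
  have hu := u_zero_ne_zero hB hz
  rw [specialFlux_eq, densityCoeffFlux, laurent, fluxCoeffU, fluxCoeffInvU,
    pd_x_pd_x_specialParameter hp hq hD hz, pd_x_specialParameter hp hq hz h0, pd_x_expSum,
    specialParameter]
  field_simp
  ring

theorem isDensityCoeff_expSum (hp : ContDiffOn ℝ ∞ p B.I) (hq : ContDiffOn ℝ ∞ q B.I)
    (hD : ∀ z ∈ B.carrier, expDiff p q z ≠ 0) :
    B.IsDensityCoeff (specialParameter p q) (expSum p q) := by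
  refine ⟨orderLT_expSum hp hq, fun z _ => pd_x_pd_x_expSum p q z, fun z hz => ?_⟩
  have h0 := hD z hz
  rw [pd_t_expSum hp hq hz, pd_x_expSum, specialParameter]
  field_simp
  ring

theorem OrderLT.exists_eqOn_expSum (hf : B.OrderLT 0 f)
    (hfxx : ∀ z ∈ B.carrier, pd .x (pd .x f) z = 4 * f z) :
    ∃ p q : ℝ → ℝ, ContDiffOn ℝ ∞ p B.I ∧ ContDiffOn ℝ ∞ q B.I ∧ EqOn f (expSum p q) B.carrier := by
  have hf2 := (const 0 (1 / 2)).mul hf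
  have hsplit (k : ℝ) (hk : k ^ 2 = 4) :
      ∃ r : ℝ → ℝ, ContDiffOn ℝ ∞ r B.I ∧
        ∀ z ∈ B.carrier, 1 / 2 * f z + k / 8 * pd .x f z = r z.t * Real.exp (k * z.x) := by
    have hfk := (const 0 (k / 8)).mul (hf.pd .x)
    refine (hf2.add hfk).exists_eq_mul_exp_of_pd_x_eq_const_mul k fun z hz => ?_
    rw [hf2.pd_add hfk _ hz, pd_const_mul, pd_const_mul, hfxx z hz]
    linear_combination -(1 / 8 * pd .x f z) * hk
  obtain ⟨p, hp, hp_eq⟩ := hsplit 2 (by norm_num)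
  obtain ⟨q, hq, hq_eq⟩ := hsplit (-2) (by norm_num)
  refine ⟨p, q, hp, hq, fun z hz => ?_⟩
  rw [JetBox.expSum, ← hp_eq z hz, ← hq_eq z hz]
  ring

end SpecialParameter

theorem evolutionRHS_eq_jetRHS (β : ℝ → ℝ → ℝ) :
    evolutionRHS β = jetRHS fun z => β z.t z.x := by
  funext z
  have hx : pd .x (fun z => β z.t z.x) = fun z => deriv (β z.t) z.x := rfl
  have hxx : pd .x (pd .x fun z => β z.t z.x) = fun z => deriv (deriv (β z.t)) z.x := rfl
  have hxxx : pd .x (pd .x (pd .x fun z => β z.t z.x)) =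
    fun z => deriv (deriv (deriv (β z.t))) z.x := rfl
  rw [evolutionRHS, jetRHS, coeffTwo, coeffOne, coeffZero, hxxx, hxx, hx]
  simp only [iteratedDeriv_succ, iteratedDeriv_zero]
  ring

theorem exists_mem_carrier {t x : ℝ} (ht : t ∈ B.I) (hx : x ∈ B.J) :
    ∃ z ∈ B.carrier, z.t = t ∧ z.x = x := by
  obtain ⟨z, hz⟩ := B.carrier_nonempty
  exact ⟨⟨t, x, z.u⟩, ⟨ht, hx, hz.2.2⟩, rfl, rfl⟩

variable {β : ℝ → ℝ → ℝ} {p q : ℝ → ℝ}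

theorem IsParameter.orderLT (hβ : B.IsParameter β) : B.OrderLT 0 fun z => β z.t z.x :=
  OrderLT.of_contDiffOn hβ.smooth

theorem IsParameter.pd_x_ne_zero (hβ : B.IsParameter β) (z : JetPoint) (hz : z ∈ B.carrier) :
    pd .x (fun z => β z.t z.x) z ≠ 0 :=
  hβ.deriv_ne_zero _ hz.1 _ hz.2.1

namespace IsSpecialParameter

variable (h : B.IsSpecialParameter β p q)
include h

theorem expDiff_ne_zero (z : JetPoint) (hz : z ∈ B.carrier) : expDiff p q z ≠ 0 :=
  h.denom_ne_zero _ hz.1 _ hz.2.1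

theorem eqOn_specialParameter : EqOn (fun z => β z.t z.x) (specialParameter p q) B.carrier :=
  fun _ hz => h.eq _ hz.1 _ hz.2.1

theorem isParameter : B.IsParameter β := by
  have hβ := (orderLT_specialParameter h.smooth_p h.smooth_q h.expDiff_ne_zero).congr
    h.eqOn_specialParameter
  obtain ⟨z₀, hz₀⟩ := B.carrier_nonempty
  refine ⟨hβ.contDiffOn_mk hz₀, fun t ht x hx => ?_⟩
  obtain ⟨z, hz, rfl, rfl⟩ := exists_mem_carrier ht hx
  have hβx : deriv (β z.t) z.x = pd .x (specialParameter p q) z :=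
    pd_congr h.eqOn_specialParameter .x hz
  have hD := h.expDiff_ne_zero z hz
  rw [hβx, pd_x_specialParameter h.smooth_p h.smooth_q hz hD]
  exact mul_ne_zero (by norm_num) (div_ne_zero (h.deriv_mul_ne_zero _ ht) (pow_ne_zero 2 hD))

theorem isDensityCoeff : B.IsDensityCoeff (fun z => β z.t z.x) (expSum p q) := by
  have hS := isDensityCoeff_expSum h.smooth_p h.smooth_q h.expDiff_ne_zero
  refine ⟨hS.orderLT, hS.pd_x_pd_x, fun z hz => ?_⟩
  rw [hS.pd_t z hz, ← h.eqOn_specialParameter hz]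

theorem isConservationLaw (hB : (0 : ℝ) ∉ B.U 0) :
    B.IsConservationLaw (evolutionRHS β) (specialDensity p q) (specialFlux p q) := by
  rw [evolutionRHS_eq_jetRHS]
  refine (h.isDensityCoeff.isConservationLaw hB h.isParameter.orderLT).congr (fun _ _ => rfl)
    fun z hz => ?_
  have hβ := h.eqOn_specialParameter
  have hβx : EqOn (pd .x fun z => β z.t z.x) (pd .x (specialParameter p q)) B.carrier :=
    fun z hz => pd_congr hβ .x hz
  rw [specialFlux_eq_densityCoeffFlux hB h.smooth_p h.smooth_q h.expDiff_ne_zero hz]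
  simp only [densityCoeffFlux, laurent, fluxCoeffU, fluxCoeffInvU, hβx hz, pd_congr hβx .x hz,
    ← hβ hz]

theorem eq_zero_of_isTrivialLaw_const_mul (hB : (0 : ℝ) ∉ B.U 0) {a : ℝ}
    (htriv : B.IsTrivialLaw F (fun z => a * specialDensity p q z) σ) : a = 0 := by
  have haS : B.OrderLT 0 fun z => a * expSum p q z :=
    (OrderLT.const 0 a).mul h.isDensityCoeff.orderLT
  have htriv_S : B.IsTrivialLaw F (fun z => a * expSum p q z / z.u 0) σ :=
    htriv.congr (fun _ _ => mul_div_assoc _ _ _) fun _ _ => rfl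
  have haS0 : EqOn (fun z => a * expSum p q z) (fun _ => 0) B.carrier :=
    fun z hz => eq_zero_of_isTrivialLaw_div_u hB haS htriv_S hz
  obtain ⟨z, hz⟩ := B.carrier_nonempty
  have haSx := pd_congr haS0 .x hz
  rw [pd_const, pd_const_mul, pd_x_expSum] at haSx
  exact (mul_eq_zero.1 haSx).resolve_right (mul_ne_zero two_ne_zero (h.expDiff_ne_zero z hz))

theorem not_isTrivialLaw (hB : (0 : ℝ) ∉ B.U 0) : ¬ B.IsTrivialLaw F (specialDensity p q) σ :=
  fun htriv => one_ne_zero (h.eq_zero_of_isTrivialLaw_const_mul hB (a := 1) (F := F) (σ := σ)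
    (htriv.congr (fun _ _ => one_mul _) fun _ _ => rfl))

theorem existsUnique_isTrivialLaw_sub (hB : (0 : ℝ) ∉ B.U 0)
    (hlaw : B.IsConservationLaw (evolutionRHS β) ρ σ) :
    ∃! a : ℝ, B.IsTrivialLaw (evolutionRHS β) (fun z => ρ z - a * specialDensity p q z)
      (fun z => σ z - a * specialFlux p q z) := by
  obtain ⟨z₀, hz₀⟩ := B.carrier_nonempty
  have hSx : pd .x (expSum p q) z₀ ≠ 0 := by
    rw [pd_x_expSum]
    exact mul_ne_zero two_ne_zero (h.expDiff_ne_zero z₀ hz₀)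
  have hspecial := h.isConservationLaw hB
  rw [evolutionRHS_eq_jetRHS] at hlaw hspecial ⊢
  obtain ⟨a, ha⟩ := IsConservationLaw.exists_isTrivialLaw_sub hB h.isParameter.orderLT
    h.isParameter.pd_x_ne_zero h.isDensityCoeff hz₀ hSx hspecial hlaw
  refine ⟨a, ha, fun a' ha' => sub_eq_zero.1 (h.eq_zero_of_isTrivialLaw_const_mul hB
    ((IsTrivialLaw.sub ha ha').congr (fun z _ => ?_) fun _ _ => rfl))⟩
  simp only [specialDensity, expSum]
  ring

end IsSpecialParameter

theorem IsParameter.exists_isSpecialParameter {h : JetPoint → ℝ} (hβ : B.IsParameter β)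
    (hh : B.IsDensityCoeff (fun z => β z.t z.x) h) (hne : ∃ z ∈ B.carrier, h z ≠ 0) :
    ∃ p q, B.IsSpecialParameter β p q := by
  obtain ⟨z₁, hz₁, hz₁_ne⟩ := hne
  obtain ⟨p, q, hp, hq, hS⟩ := hh.orderLT.exists_eqOn_expSum hh.pd_x_pd_x
  have hhx (z) (hz : z ∈ B.carrier) : pd .x h z = 2 * expDiff p q z := by
    rw [pd_congr hS _ hz, pd_x_expSum]
  have hD (z) (hz : z ∈ B.carrier) : expDiff p q z ≠ 0 := fun h0 =>
    hz₁_ne (hh.eq_zero_of_pd_x_eq_zero hβ.orderLT hβ.pd_x_ne_zero hz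
      (by rw [hhx z hz, h0, mul_zero]) hz₁)
  have hβ_eq : EqOn (fun z => β z.t z.x) (specialParameter p q) B.carrier := fun z hz => by
    have hht := hh.pd_t z hz
    rw [pd_congr hS _ hz, pd_t_expSum hp hq hz, hhx z hz] at hht
    have h0 := hD z hz
    rw [specialParameter, hht]
    field_simp
    ring
  refine ⟨p, q, hp, hq, fun t ht hpq => ?_, fun t ht x hx => ?_, fun t ht x hx => ?_⟩
  · obtain ⟨x, hx⟩ := B.nonempty_J
    obtain ⟨z, hz, rfl, -⟩ := exists_mem_carrier ht hx
    refine hβ.pd_x_ne_zero z hz ?_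
    rw [pd_congr hβ_eq _ hz, pd_x_specialParameter hp hq hz (hD z hz), hpq, zero_div, mul_zero]
  · obtain ⟨z, hz, rfl, rfl⟩ := exists_mem_carrier ht hx
    exact hD z hz
  · obtain ⟨z, hz, rfl, rfl⟩ := exists_mem_carrier ht hx
    exact hβ_eq hz

theorem IsParameter.exists_isSpecialParameter_of_not_isTrivialLaw (hβ : B.IsParameter β)
    (hB : (0 : ℝ) ∉ B.U 0) (hlaw : B.IsConservationLaw (evolutionRHS β) ρ σ)
    (hnontriv : ¬ B.IsTrivialLaw (evolutionRHS β) ρ σ) : ∃ p q, B.IsSpecialParameter β p q := by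
  rw [evolutionRHS_eq_jetRHS] at hlaw hnontriv
  obtain ⟨h, hh, hne⟩ :=
    hlaw.exists_isDensityCoeff_ne_zero hB hβ.orderLT hβ.pd_x_ne_zero hnontriv
  exact hβ.exists_isSpecialParameter hh hne

end JetBox

end

theorem mainTheorem2 (B : JetBox) (hB : (0 : ℝ) ∉ B.U 0) (β : ℝ → ℝ → ℝ) :
    (B.IsParameter β →
      ((∃ ρ σ : JetPoint → ℝ, B.IsConservationLaw (evolutionRHS β) ρ σ ∧
          ¬ B.IsTrivialLaw (evolutionRHS β) ρ σ) ↔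
        ∃ p q : ℝ → ℝ, B.IsSpecialParameter β p q)) ∧
    (∀ p q : ℝ → ℝ, B.IsSpecialParameter β p q →
      B.IsParameter β ∧
      B.IsConservationLaw (evolutionRHS β) (specialDensity p q) (specialFlux p q) ∧
      ¬ B.IsTrivialLaw (evolutionRHS β) (specialDensity p q) (specialFlux p q) ∧
      ∀ ρ σ : JetPoint → ℝ, B.IsConservationLaw (evolutionRHS β) ρ σ →
        ∃! c : ℝ, B.IsTrivialLaw (evolutionRHS β)
          (fun z => ρ z - c * specialDensity p q z)
          (fun z => σ z - c * specialFlux p q z)) := by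
  refine ⟨fun hβ => ⟨?_, ?_⟩, fun p q h => ⟨h.isParameter, h.isConservationLaw hB,
    h.not_isTrivialLaw hB, fun ρ σ hl => h.existsUnique_isTrivialLaw_sub hB hl⟩⟩
  · rintro ⟨ρ, σ, hl, hnt⟩
    exact hβ.exists_isSpecialParameter_of_not_isTrivialLaw hB hl hnt
  · rintro ⟨p, q, h⟩
    exact ⟨_, _, h.isConservationLaw hB, h.not_isTrivialLaw hB⟩
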